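/- Let $Z,Z'$ be independent standard Gaussian random variables. For $K>0$ let $S_{r,K}=\{z\in\mathbb R: |z|\le K\}$ (the rectangle constraint) and $S_{u,K}=\{z\in\mathbb R: |z|\ge K\}$ (the $u$-function constraint), and for $t\in\{r,u\}$ put $p_{t,K}=\mathbb P[Z\in S_{t,K}]$. Let $\mathbf X(N,M)$ be an $M\times N$ matrix with i.i.d. Gaussian entries of mean $0$ and variance $1/N$, and let $\mathcal E^t_K(N,M)$ be the event that there is some $\mathbf w\in\{\pm1\}^N$ with $\sum_{i=1}^N X_{\mu i}w_i\in S_{t,K}$ for all $\mu=1,\dots,M$. The storage capacity is $$\alpha_c^t(K)=\inf\Big\{\alpha\ge 0:\ \lim_{N\to\infty}\mathbb P[\mathcal E^t_K(N,\lfloor\alpha N\rfloor)]=0\Big\}.$$ For $\beta\in(0,1)$ and $\alpha>0$ let $q_{t,K}(\beta)=\mathbb P[\sqrt\beta Z+\sqrt{1-\beta}Z'\in S_{t,K}\ \text{and}\ \sqrt\beta Z-\sqrt{1-\beta}Z'\in S_{t,K}]$ and $$F_{t,K,\alpha}(\beta)=-\beta\log\beta-(1-\beta)\log(1-\beta)+\alpha\log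 q_{t,K}(\beta).$$ Hypothesis $\mathcal H_t(K)$: for every $\alpha$ with $0<\alpha<-\log 2/\log p_{t,K}$ and $F''_{t,K,\alpha}(1/2)<0$, there is exactly one $\beta\in(1/2,1)$ with $F'_{t,K,\alpha}(\beta)=0$. Theorem. 1. For every $K>0$ for which $\mathcal H_r(K)$ holds, $\alpha_c^r(K)=-\log 2/\log p_{r,K}$. 2. The equation $\pi\,p_{u,K}^2\,e^{K^2}\log p_{u,K}=-2(\log 2)K^2$ has exactly one solution $K=K^*$ in $(0,\infty)$, it satisfies $|K^*-0.817|<0.0005$, and for every $K\in(0,K^*)$ for which $\mathcal H_u(K)$ holds, $\alpha_c^u(K)=-\log 2/\log p_{u,K}$. -/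

import Mathlib

open MeasureTheory ProbabilityTheory Filter Topology
open scoped NNReal

noncomputable section

namespace SymmetricPerceptron

/-- The rectangle constraint set: the values `z` with `|z| ≤ K`. -/
def rectangle (K : ℝ) : Set ℝ := {z | |z| ≤ K}

/-- The `u`-function constraint set: the values `z` with `K ≤ |z|`. -/
def uFunction (K : ℝ) : Set ℝ := {z | K ≤ |z|}

/-- The law of the `M × N` pattern matrix with i.i.d. entries that are centred Gaussians of
variance `1 / N`. -/
def patternLaw (N M : ℕ) : Measure (Fin M → Fin N → ℝ) :=
  Measure.pi fun _ => Measure.pi fun _ => gaussianReal 0 ((N : ℝ≥0)⁻¹)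

/-- The set `{-1, 1}^N` of binary weight vectors. -/
def weights (N : ℕ) : Finset (Fin N → ℝ) := Fintype.piFinset fun _ => {-1, 1}

/-- The partition function: the sum over the weight vectors `w` of the product over the patterns
`X μ` of the indicator that `∑ i, X μ i * w i` lies in the constraint set `S`. -/
def partitionFunction (S : Set ℝ) {N M : ℕ} (X : Fin M → Fin N → ℝ) : ℝ :=
  ∑ w ∈ weights N, ∏ μ : Fin M, S.indicator 1 (∑ i : Fin N, X μ i * w i)

/-- The probability that at least one weight vector satisfies all `M` constraints. -/
def satProb (S : Set ℝ) (N M : ℕ) : ℝ :=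
  (patternLaw N M).real {X | 1 ≤ partitionFunction S X}

/-- The storage capacity: the infimum of the constraint densities `α` for which the probability
that a solution exists tends to zero, with `M = ⌊α N⌋` patterns. -/
def storageCapacity (S : Set ℝ) : ℝ :=
  sInf {α : ℝ | 0 ≤ α ∧ Tendsto (fun N : ℕ => satProb S N ⌊α * (N : ℝ)⌋₊) atTop (𝓝 0)}

/-- The probability that a standard Gaussian variable lies in `S`. -/
def p (S : Set ℝ) : ℝ := (gaussianReal 0 1).real S

/-- The probability that `√β Z + √(1-β) Z'` and `√β Z - √(1-β) Z'` both lie in `S`, where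
`Z, Z'` are independent standard Gaussian variables. -/
def q (S : Set ℝ) (β : ℝ) : ℝ :=
  ((gaussianReal 0 1).prod (gaussianReal 0 1)).real
    {z : ℝ × ℝ | √β * z.1 + √(1 - β) * z.2 ∈ S ∧ √β * z.1 - √(1 - β) * z.2 ∈ S}

/-- The annealed capacity `-log 2 / log p`. -/
def annealedCapacity (S : Set ℝ) : ℝ := -Real.log 2 / Real.log (p S)

/-- The second moment entropy `H(β) + α log q(β)`, with `H` the Shannon entropy
`-β log β - (1-β) log (1-β)`. -/
def F (S : Set ℝ) (α β : ℝ) : ℝ := Real.binEntropy β + α * Real.log (q S β)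

/-- The numerical hypothesis for the constraint set `S`: for every density `α` below the annealed
capacity such that the second derivative of `F` at `1/2` is negative, the derivative of `F` has
exactly one zero in the open interval `(1/2, 1)`. -/
def NumericalHypothesis (S : Set ℝ) : Prop :=
  ∀ α : ℝ, 0 < α → α < annealedCapacity S → iteratedDeriv 2 (F S α) (1 / 2) < 0 →
    ∃! β : ℝ, β ∈ Set.Ioo (1 / 2 : ℝ) 1 ∧ deriv (F S α) β = 0

/-- The equation `π p_u(K)^2 e^(K^2) log p_u(K) = -2 (log 2) K^2` for the threshold `K`. -/
def CrossingEquation (K : ℝ) : Prop :=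
  Real.pi * p (uFunction K) ^ 2 * Real.exp (K ^ 2) * Real.log (p (uFunction K)) =
    -2 * Real.log 2 * K ^ 2

end SymmetricPerceptron

end

/-!
The proof is the second moment method. For a constraint set `S`, the partition function `Z` counts
solutions, and `E Z = 2^N p^M`, `E Z² = 2^N ∑ l, (N choose l) q(l/N)^M`: a pattern sees two weight
vectors that agree on `l` coordinates as a pair `(A + B, A - B)` of sums over complementary index
sets. Markov's inequality makes the satisfiability probability vanish above the annealed capacity
(`tendsto_satProb_zero`). Below it, the Cauchy-Schwarz inequality (`sq_first_moment_le`) bounds the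
probability away from zero as soon as `E Z² = O((E Z)²)`, which gives `storageCapacity_eq`.

The second moment is bounded by a discrete Laplace argument (`exists_second_moment_bound`). Away
from `l = N / 2` it suffices that `F` is strictly maximal at `1 / 2`. Near `N / 2` the logarithm of
`q / p²` is at most quadratic, and the binomial law is sub-Gaussian, so that linearizing the
exponential of the square by an auxiliary Gaussian variable bounds the sum
(`exists_binomial_exp_sq_bound`). Strict maximality follows from uniqueness of the critical point:
`F` has a strict local maximum at `1 / 2` and `F 1 < F (1 / 2)` below the annealed capacity, so a
value `F β ≥ F (1 / 2)` would force both a local minimum and a local maximum in `(1 / 2, 1)`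
(`lt_of_unique_critical_point`).

What remains is `F'' (1 / 2) < 0` for all densities below the annealed capacity. For the rectangle,
the pair constraint is the rhombus `√β |x| + √(1-β) |y| ≤ K`, and polar coordinates express its
Gaussian measure as the integral of a fixed function over an interval of length `π / 2` that moves
with `β` (`q_rectangle_eq`); hence `q` is continuous on `[0, 1]` and has an elementary derivative
`pairSlope`. The `u`-function case differs from it by an additive constant (`q_uFunction`). In both
cases the condition becomes `2 (log 2) K² ≤ π p² e^{K²} (-log p)`.

For the `u`-function the ratio of the two sides is strictly decreasing by the two classical bounds
for the Mills ratio (`strictAntiOn_crossingRatio`), so that the crossing is unique; it is located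
by rational bounds from the series of `e^{K²/2} ∫_0^K e^{-x²/2} dx`. For the rectangle, write
`m = e^{K²/2} ∫_0^K e^{-x²/2} dx / K`, `u = -log p` and `B = K m' = 1 + (K² - 1) m`; the inequality
is `log 2 ≤ m² u`. Left of `1.367` the function `u - log 2 / m²` decreases; right of it `m² u`
increases because `2 B u ≥ 1` there; and at `1.367` the inequality is checked numerically
(`rectangle_curvature`).
-/

namespace SymmetricPerceptron

/-! ### Laws of the row sums -/

lemma map_finset_sum_gaussianReal {Ω ι : Type*} [MeasurableSpace Ω] {P : Measure Ω}
    [IsProbabilityMeasure P] {X : ι → Ω → ℝ} {v : ℝ≥0} (hX : ∀ i, Measurable (X i))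
    (hindep : iIndepFun X P) (hlaw : ∀ i, P.map (X i) = gaussianReal 0 v) (s : Finset ι) :
    P.map (∑ i ∈ s, X i) = gaussianReal 0 (s.card * v) := by
  classical
  induction s using Finset.induction_on with
  | empty =>
    simp only [Finset.sum_empty, Finset.card_empty, Nat.cast_zero, zero_mul, gaussianReal_zero_var]
    rw [show (0 : Ω → ℝ) = fun _ => 0 from rfl, Measure.map_const]
    simp
  | insert a s ha ih =>
    have h := hindep.indepFun_finsetSum_of_notMem hX ha
    rw [Finset.sum_insert ha, add_comm,
      gaussianReal_add_gaussianReal_of_indepFun h ih (hlaw a), Finset.card_insert_of_notMem ha]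
    congr 1
    · simp
    · push_cast; ring

lemma gaussianReal_map_mul_sqrt (v : ℝ≥0) :
    (gaussianReal 0 1).map (fun z => √(v : ℝ) * z) = gaussianReal 0 v := by
  rw [gaussianReal_map_const_mul]
  congr 1
  · simp
  · ext; simp

/-- The coordinates of one pattern, multiplied by the signs of a weight vector, are again
independent centred Gaussians, so that sums over disjoint index sets have a product law. -/
lemma map_signed_sums_prod {N : ℕ} (hN : N ≠ 0) {w : Fin N → ℝ} (hw : w ∈ weights N)
    (I : Finset (Fin N)) :
    (Measure.pi fun _ : Fin N => gaussianReal 0 ((N : ℝ≥0)⁻¹)).map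
      (fun x => (∑ i ∈ I, x i * w i, ∑ i ∈ Iᶜ, x i * w i)) =
    ((gaussianReal 0 1).prod (gaussianReal 0 1)).map
      (fun z => (√((I.card : ℝ) / N) * z.1, √(1 - (I.card : ℝ) / N) * z.2)) := by
  classical
  set P := Measure.pi fun _ : Fin N => gaussianReal 0 ((N : ℝ≥0)⁻¹)
  have hw2 : ∀ i, w i ^ 2 = 1 := by
    intro i
    have := Fintype.mem_piFinset.1 hw i
    simp only [Finset.mem_insert, Finset.mem_singleton] at this
    rcases this with h | h <;> rw [h] <;> norm_num
  have hmeas : ∀ i, Measurable (fun x : Fin N → ℝ => x i * w i) := fun i => by fun_prop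
  have hindep : iIndepFun (fun i (x : Fin N → ℝ) => x i * w i) P :=
    iIndepFun_pi (X := fun i (y : ℝ) => y * w i)
      (μ := fun _ : Fin N => gaussianReal 0 ((N : ℝ≥0)⁻¹))
      (fun i => by fun_prop)
  have hlaw : ∀ i, P.map (fun x => x i * w i) = gaussianReal 0 ((N : ℝ≥0)⁻¹) := by
    intro i
    have h1 : P.map (Function.eval i) = gaussianReal 0 ((N : ℝ≥0)⁻¹) :=
      (measurePreserving_eval (fun _ : Fin N => gaussianReal 0 ((N : ℝ≥0)⁻¹)) i).map_eq
    have h2 : (fun x : Fin N → ℝ => x i * w i) = (fun y => y * w i) ∘ Function.eval i := rfl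
    rw [h2, ← Measure.map_map (by fun_prop) (by fun_prop), h1, gaussianReal_map_mul_const]
    congr 1
    · simp
    · ext; simp [hw2 i]
  have hsum := map_finset_sum_gaussianReal hmeas hindep hlaw
  have hfun : ∀ s : Finset (Fin N), (∑ i ∈ s, fun x : Fin N → ℝ => x i * w i) =
      fun x => ∑ i ∈ s, x i * w i := fun s => by ext x; simp
  have hind : IndepFun (fun x => ∑ i ∈ I, x i * w i) (fun x => ∑ i ∈ Iᶜ, x i * w i) P := by
    have h := hindep.indepFun_finset I Iᶜ disjoint_compl_right hmeas
    have h' := h.comp (φ := fun y : I → ℝ => ∑ i, y i)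
      (ψ := fun y : (Iᶜ : Finset (Fin N)) → ℝ => ∑ i, y i)
      (by fun_prop) (by fun_prop)
    convert! h' using 1
    · ext x
      exact (Finset.sum_coe_sort I (fun i => x i * w i)).symm
    · ext x
      exact (Finset.sum_coe_sort Iᶜ (fun i => x i * w i)).symm
  rw [(indepFun_iff_map_prod_eq_prod_map_map
    (by fun_prop : Measurable fun x : Fin N → ℝ => ∑ i ∈ I, x i * w i).aemeasurable
    (by fun_prop : Measurable fun x : Fin N → ℝ => ∑ i ∈ Iᶜ, x i * w i).aemeasurable).1 hind,
    ← hfun I, ← hfun Iᶜ, hsum, hsum]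
  have hNr : (N : ℝ) ≠ 0 := by exact_mod_cast hN
  have hc : ((Iᶜ.card : ℕ) : ℝ) = N - I.card := by
    rw [Finset.card_compl, Fintype.card_fin, Nat.cast_sub (by simpa using I.card_le_univ)]
  have e1 : (I.card : ℝ) / N = ((I.card * (N : ℝ≥0)⁻¹ : ℝ≥0) : ℝ) := by
    push_cast; rw [div_eq_mul_inv]
  have e2 : 1 - (I.card : ℝ) / N = ((Iᶜ.card * (N : ℝ≥0)⁻¹ : ℝ≥0) : ℝ) := by
    push_cast; rw [hc]; field_simp
  rw [e2, e1]
  have := Measure.map_prod_map (gaussianReal 0 1) (gaussianReal 0 1)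
    (f := fun z => √((I.card * (N : ℝ≥0)⁻¹ : ℝ≥0) : ℝ) * z)
    (g := fun z => √((Iᶜ.card * (N : ℝ≥0)⁻¹ : ℝ≥0) : ℝ) * z) (by fun_prop) (by fun_prop)
  rw [gaussianReal_map_mul_sqrt, gaussianReal_map_mul_sqrt] at this
  exact this

/-- Two weight vectors that agree exactly on `I` satisfy one constraint simultaneously with
probability `q (|I| / N)`. -/
lemma pair_row_prob {S : Set ℝ} (hS : MeasurableSet S) {N : ℕ} (hN : N ≠ 0) {w w' : Fin N → ℝ}
    (hw : w ∈ weights N) (I : Finset (Fin N))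
    (hI : ∀ i, w' i = if i ∈ I then w i else -w i) :
    (Measure.pi fun _ : Fin N => gaussianReal 0 ((N : ℝ≥0)⁻¹)).real
      {x | ∑ i, x i * w i ∈ S ∧ ∑ i, x i * w' i ∈ S} = q S ((I.card : ℝ) / N) := by
  classical
  have hT : MeasurableSet {z : ℝ × ℝ | z.1 + z.2 ∈ S ∧ z.1 - z.2 ∈ S} :=
    (measurableSet_preimage (by fun_prop : Measurable fun z : ℝ × ℝ => z.1 + z.2) hS).inter
      (measurableSet_preimage (by fun_prop : Measurable fun z : ℝ × ℝ => z.1 - z.2) hS)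
  have h := congrArg (fun m => m.real {z : ℝ × ℝ | z.1 + z.2 ∈ S ∧ z.1 - z.2 ∈ S})
    (map_signed_sums_prod hN hw I)
  beta_reduce at h
  rw [map_measureReal_apply (by fun_prop) hT, map_measureReal_apply (by fun_prop) hT] at h
  rw [q]
  convert! h using 2
  ext x
  have h1 : ∑ i, x i * w i = ∑ i ∈ I, x i * w i + ∑ i ∈ Iᶜ, x i * w i :=
    (Finset.sum_add_sum_compl I _).symm
  have h2 : ∑ i, x i * w' i = ∑ i ∈ I, x i * w i - ∑ i ∈ Iᶜ, x i * w i := by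
    rw [← Finset.sum_add_sum_compl I, sub_eq_add_neg, ← Finset.sum_neg_distrib]
    congr 1
    · exact Finset.sum_congr rfl fun i hi => by rw [hI, if_pos hi]
    · exact Finset.sum_congr rfl fun i hi => by
        rw [hI, if_neg (Finset.mem_compl.1 hi)]; ring
  simp only [Set.mem_ofPred_eq, Set.mem_preimage, h1, h2]

lemma q_one (S : Set ℝ) : q S 1 = p S := by
  have : {z : ℝ × ℝ | √1 * z.1 + √(1 - 1) * z.2 ∈ S ∧ √1 * z.1 - √(1 - 1) * z.2 ∈ S} =
      S ×ˢ Set.univ := by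
    ext z; simp
  rw [q, this, measureReal_prod_prod, p]
  simp

lemma row_prob {S : Set ℝ} (hS : MeasurableSet S) {N : ℕ} (hN : N ≠ 0) {w : Fin N → ℝ}
    (hw : w ∈ weights N) :
    (Measure.pi fun _ : Fin N => gaussianReal 0 ((N : ℝ≥0)⁻¹)).real
      {x | ∑ i, x i * w i ∈ S} = p S := by
  have h := pair_row_prob hS hN hw (w' := w) Finset.univ (by simp)
  have hNr : (N : ℝ) ≠ 0 := by exact_mod_cast hN
  simpa [hNr, q_one] using h

/-! ### First and second moments of the partition function -/

instance (N M : ℕ) : IsProbabilityMeasure (patternLaw N M) := by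
  unfold patternLaw; infer_instance

lemma card_weights (N : ℕ) : (weights N).card = 2 ^ N := by
  have : ({-1, 1} : Finset ℝ).card = 2 := Finset.card_pair (by norm_num)
  simp [weights, Fintype.card_piFinset, this]

lemma measurable_indicator_row {S : Set ℝ} (hS : MeasurableSet S) {N : ℕ} (w : Fin N → ℝ) :
    Measurable fun x : Fin N → ℝ => S.indicator (1 : ℝ → ℝ) (∑ i, x i * w i) :=
  (measurable_one.indicator hS).comp (by fun_prop)

lemma measurable_partitionFunction {S : Set ℝ} (hS : MeasurableSet S) (N M : ℕ) :
    Measurable (partitionFunction S : (Fin M → Fin N → ℝ) → ℝ) := by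
  unfold partitionFunction
  refine Finset.measurable_sum _ fun w _ => Finset.measurable_prod _ fun μ _ => ?_
  exact (measurable_indicator_row hS w).comp (measurable_pi_apply μ)

lemma prod_indicator_nonneg (S : Set ℝ) {N M : ℕ} (X : Fin M → Fin N → ℝ) (w : Fin N → ℝ) :
    0 ≤ ∏ μ : Fin M, S.indicator (1 : ℝ → ℝ) (∑ i, X μ i * w i) :=
  Finset.prod_nonneg fun _ _ => Set.indicator_nonneg (fun _ _ => zero_le_one) _

lemma prod_indicator_le_one (S : Set ℝ) {N M : ℕ} (X : Fin M → Fin N → ℝ) (w : Fin N → ℝ) :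
    ∏ μ : Fin M, S.indicator (1 : ℝ → ℝ) (∑ i, X μ i * w i) ≤ 1 :=
  Finset.prod_le_one (fun _ _ => Set.indicator_nonneg (fun _ _ => zero_le_one) _)
    fun _ _ => Set.indicator_le' (fun _ _ => le_rfl) (fun _ _ => zero_le_one) _

lemma partitionFunction_nonneg (S : Set ℝ) {N M : ℕ} (X : Fin M → Fin N → ℝ) :
    0 ≤ partitionFunction S X :=
  Finset.sum_nonneg fun w _ => prod_indicator_nonneg S X w

lemma partitionFunction_le (S : Set ℝ) {N M : ℕ} (X : Fin M → Fin N → ℝ) :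
    partitionFunction S X ≤ 2 ^ N := by
  calc partitionFunction S X ≤ ∑ w ∈ weights N, (1 : ℝ) :=
        Finset.sum_le_sum fun w _ => prod_indicator_le_one S X w
    _ = 2 ^ N := by simp [card_weights]

/-- The partition function counts solutions, so it vanishes as soon as it is less than one. -/
lemma partitionFunction_eq_zero {S : Set ℝ} {N M : ℕ} {X : Fin M → Fin N → ℝ}
    (h : ¬ 1 ≤ partitionFunction S X) : partitionFunction S X = 0 := by
  refine Finset.sum_eq_zero fun w hw => ?_
  by_contra hne
  apply h
  have h01 : ∏ μ : Fin M, S.indicator (1 : ℝ → ℝ) (∑ i, X μ i * w i) = 1 := by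
    refine Finset.prod_eq_one fun μ _ => ?_
    have := Finset.prod_ne_zero_iff.1 hne μ (Finset.mem_univ _)
    rw [Set.indicator_of_mem (by by_contra hh; exact this (Set.indicator_of_notMem hh _))]
    rfl
  rw [← h01]
  exact Finset.single_le_sum (f := fun w : Fin N → ℝ =>
    ∏ μ : Fin M, S.indicator (1 : ℝ → ℝ) (∑ i, X μ i * w i))
    (fun w _ => prod_indicator_nonneg S X w) hw

lemma integral_prod_rows {N M : ℕ} (f : (Fin N → ℝ) → ℝ) :
    ∫ X, ∏ μ : Fin M, f (X μ) ∂patternLaw N M =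
      (∫ x, f x ∂(Measure.pi fun _ : Fin N => gaussianReal 0 ((N : ℝ≥0)⁻¹))) ^ M := by
  rw [patternLaw, integral_fintype_prod_eq_prod (fun _ : Fin M => f)]
  simp

lemma integrable_partitionFunction {S : Set ℝ} (hS : MeasurableSet S) (N M : ℕ) :
    Integrable (partitionFunction S) (patternLaw N M) :=
  Integrable.of_bound (measurable_partitionFunction hS N M).aestronglyMeasurable (2 ^ N)
    (Eventually.of_forall fun X => by
      rw [Real.norm_of_nonneg (partitionFunction_nonneg S X)]; exact partitionFunction_le S X)

lemma integrable_partitionFunction_sq {S : Set ℝ} (hS : MeasurableSet S) (N M : ℕ) :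
    Integrable (fun X => partitionFunction S X ^ 2) (patternLaw N M) :=
  Integrable.of_bound ((measurable_partitionFunction hS N M).pow_const 2).aestronglyMeasurable
    ((2 ^ N) ^ 2) (Eventually.of_forall fun X => by
      rw [Real.norm_of_nonneg (sq_nonneg _)]
      exact pow_le_pow_left₀ (partitionFunction_nonneg S X) (partitionFunction_le S X) 2)

lemma integrable_prod_rows {N M : ℕ} {f : (Fin N → ℝ) → ℝ}
    (hf : Integrable f (Measure.pi fun _ : Fin N => gaussianReal 0 ((N : ℝ≥0)⁻¹))) :
    Integrable (fun X : Fin M → Fin N → ℝ => ∏ μ, f (X μ)) (patternLaw N M) :=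
  Integrable.fintype_prod (f := fun _ : Fin M => f) fun _ => hf

lemma integral_partitionFunction {S : Set ℝ} (hS : MeasurableSet S) {N : ℕ} (hN : N ≠ 0) (M : ℕ) :
    ∫ X, partitionFunction S X ∂patternLaw N M = 2 ^ N * p S ^ M := by
  have hT : ∀ w : Fin N → ℝ, MeasurableSet {x : Fin N → ℝ | ∑ i, x i * w i ∈ S} := fun w =>
    measurableSet_preimage (by fun_prop : Measurable fun x : Fin N → ℝ => ∑ i, x i * w i) hS
  have hind : ∀ (w x : Fin N → ℝ), S.indicator (1 : ℝ → ℝ) (∑ i, x i * w i) =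
      {x : Fin N → ℝ | ∑ i, x i * w i ∈ S}.indicator 1 x := fun w x => by
    rfl
  unfold partitionFunction
  simp_rw [hind]
  have hint : ∀ w : Fin N → ℝ,
      Integrable ({x : Fin N → ℝ | ∑ i, x i * w i ∈ S}.indicator (1 : (Fin N → ℝ) → ℝ))
        (Measure.pi fun _ : Fin N => gaussianReal 0 ((N : ℝ≥0)⁻¹)) := fun w =>
    (integrable_const (1 : ℝ)).indicator (hT w)
  rw [integral_finsetSum _ fun w _ => integrable_prod_rows (hint w)]
  rw [Finset.sum_congr rfl (g := fun _ => p S ^ M) ?_, Finset.sum_const, card_weights, nsmul_eq_mul]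
  · push_cast; rfl
  · intro w hw
    rw [integral_prod_rows, integral_indicator_one (hT w), row_prob hS hN hw]

/-- Summing over ordered pairs of weight vectors amounts to summing over one vector and the set
on which the other agrees with it. -/
lemma sum_weights_eq_sum_powerset {N : ℕ} {w : Fin N → ℝ} (hw : w ∈ weights N)
    (g : (Fin N → ℝ) → ℝ) :
    ∑ w' ∈ weights N, g w' =
      ∑ I ∈ (Finset.univ : Finset (Fin N)).powerset, g fun i => if i ∈ I then w i else -w i := by
  classical
  have hmem : ∀ {v : Fin N → ℝ}, v ∈ weights N ↔ ∀ i, v i = -1 ∨ v i = 1 := by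
    intro v; simp [weights, Fintype.mem_piFinset]
  have hw' := hmem.1 hw
  symm
  refine Finset.sum_bij' (fun I _ i => if i ∈ I then w i else -w i)
    (fun w' _ => Finset.univ.filter fun i => w' i = w i) ?_ ?_ ?_ ?_ ?_
  · intro I _
    refine hmem.2 fun i => ?_
    rcases hw' i with h | h <;> by_cases hi : i ∈ I <;> simp [hi, h]
  · intro w' _; simp
  · intro I _
    ext i
    rcases hw' i with h | h <;> by_cases hi : i ∈ I <;> simp [hi, h] <;> norm_num
  · intro w' hw''
    ext i
    rcases hw' i with h | h <;> rcases hmem.1 hw'' i with h' | h' <;> simp [h, h'] <;> norm_num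
  · intro I _; rfl

lemma integral_partitionFunction_sq {S : Set ℝ} (hS : MeasurableSet S) {N : ℕ} (hN : N ≠ 0)
    (M : ℕ) :
    ∫ X, partitionFunction S X ^ 2 ∂patternLaw N M =
      2 ^ N * ∑ l ∈ Finset.range (N + 1), (N.choose l : ℝ) * q S ((l : ℝ) / N) ^ M := by
  classical
  have hT : ∀ w w' : Fin N → ℝ,
      MeasurableSet {x : Fin N → ℝ | ∑ i, x i * w i ∈ S ∧ ∑ i, x i * w' i ∈ S} := fun w w' =>
    (measurableSet_preimage (by fun_prop : Measurable fun x : Fin N → ℝ => ∑ i, x i * w i) hS).inter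
    (measurableSet_preimage (by fun_prop : Measurable fun x : Fin N → ℝ => ∑ i, x i * w' i) hS)
  have hsq : ∀ X : Fin M → Fin N → ℝ, partitionFunction S X ^ 2 =
      ∑ w ∈ weights N, ∑ w' ∈ weights N, ∏ μ : Fin M,
        {x : Fin N → ℝ | ∑ i, x i * w i ∈ S ∧ ∑ i, x i * w' i ∈ S}.indicator 1 (X μ) := by
    intro X
    rw [partitionFunction, sq, Finset.sum_mul_sum]
    refine Finset.sum_congr rfl fun w _ => Finset.sum_congr rfl fun w' _ => ?_
    rw [← Finset.prod_mul_distrib]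
    refine Finset.prod_congr rfl fun μ _ => ?_
    by_cases h1 : ∑ i, X μ i * w i ∈ S <;> by_cases h2 : ∑ i, X μ i * w' i ∈ S <;>
      simp [h1, h2]
  have hint : ∀ w w' : Fin N → ℝ,
      Integrable ({x : Fin N → ℝ | ∑ i, x i * w i ∈ S ∧ ∑ i, x i * w' i ∈ S}.indicator
        (1 : (Fin N → ℝ) → ℝ)) (Measure.pi fun _ : Fin N => gaussianReal 0 ((N : ℝ≥0)⁻¹)) :=
    fun w w' => (integrable_const (1 : ℝ)).indicator (hT w w')
  simp_rw [hsq]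
  rw [integral_finsetSum _ fun w _ => integrable_finsetSum _ fun w' _ =>
    integrable_prod_rows (hint w w')]
  rw [Finset.sum_congr rfl (g := fun _ => ∑ l ∈ Finset.range (N + 1),
    (N.choose l : ℝ) * q S ((l : ℝ) / N) ^ M) ?_, Finset.sum_const, card_weights, nsmul_eq_mul]
  · push_cast; rfl
  · intro w hw
    rw [integral_finsetSum _ fun w' _ => integrable_prod_rows (hint w w'),
      sum_weights_eq_sum_powerset hw]
    rw [Finset.sum_congr rfl (g := fun I : Finset (Fin N) => q S ((I.card : ℝ) / N) ^ M) ?_,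
      Finset.sum_powerset_apply_card (fun l => q S ((l : ℝ) / N) ^ M)]
    · simp
    · intro I _
      rw [integral_prod_rows, integral_indicator_one (hT w _),
        pair_row_prob hS hN hw I fun _ => rfl]

lemma measurableSet_sat {S : Set ℝ} (hS : MeasurableSet S) (N M : ℕ) :
    MeasurableSet {X : Fin M → Fin N → ℝ | 1 ≤ partitionFunction S X} :=
  measurableSet_le measurable_const (measurable_partitionFunction hS N M)

/-- Markov's inequality for the partition function. -/
lemma satProb_le {S : Set ℝ} (hS : MeasurableSet S) {N : ℕ} (hN : N ≠ 0) (M : ℕ) :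
    satProb S N M ≤ 2 ^ N * p S ^ M := by
  have h := mul_meas_ge_le_integral_of_nonneg (μ := patternLaw N M)
    (Eventually.of_forall fun X => partitionFunction_nonneg S X)
    (integrable_partitionFunction hS N M) 1
  rwa [one_mul, integral_partitionFunction hS hN] at h

/-- The Cauchy-Schwarz inequality for the partition function and the indicator of the
satisfiability event. -/
lemma sq_first_moment_le {S : Set ℝ} (hS : MeasurableSet S) {N : ℕ} (hN : N ≠ 0) (M : ℕ) :
    (2 ^ N * p S ^ M) ^ 2 ≤ satProb S N M *
      (2 ^ N * ∑ l ∈ Finset.range (N + 1), (N.choose l : ℝ) * q S ((l : ℝ) / N) ^ M) := by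
  rw [← integral_partitionFunction hS hN, ← integral_partitionFunction_sq hS hN]
  set P := patternLaw N M
  set Z : (Fin M → Fin N → ℝ) → ℝ := partitionFunction S
  set A := {X : Fin M → Fin N → ℝ | 1 ≤ partitionFunction S X}
  have hA : MeasurableSet A := measurableSet_sat hS N M
  have hZ := integrable_partitionFunction hS N M
  have hZ2 := integrable_partitionFunction_sq hS N M
  have hA1 : Integrable (A.indicator (1 : (Fin M → Fin N → ℝ) → ℝ)) P :=
    (integrable_const (1 : ℝ)).indicator hA
  -- The quadratic polynomial `t ↦ ∫ (t Z - 1_A)^2` is nonnegative: its discriminant is `≤ 0`.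
  have key : ∀ t : ℝ, 0 ≤ (∫ X, Z X ^ 2 ∂P) * (t * t) + (-2 * ∫ X, Z X ∂P) * t + satProb S N M := by
    intro t
    have h0 : 0 ≤ ∫ X, (t * Z X - A.indicator 1 X) ^ 2 ∂P :=
      integral_nonneg fun X => sq_nonneg _
    have h1 : ∀ X, (t * Z X - A.indicator 1 X) ^ 2 =
        (t * t) * Z X ^ 2 + (-2 * t) * Z X + A.indicator (1 : (Fin M → Fin N → ℝ) → ℝ) X := by
      intro X
      by_cases hX : X ∈ A
      · rw [Set.indicator_of_mem hX]; simp only [Pi.one_apply]; ring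
      · rw [Set.indicator_of_notMem hX, show Z X = 0 from partitionFunction_eq_zero hX]; ring
    simp_rw [h1] at h0
    have i1 : Integrable (fun X => t * t * Z X ^ 2) P := hZ2.const_mul _
    have i2 : Integrable (fun X => -2 * t * Z X) P := hZ.const_mul _
    have i12 : Integrable (fun X => t * t * Z X ^ 2 + -2 * t * Z X) P := i1.add i2
    rw [integral_add i12 hA1, integral_add i1 i2, integral_const_mul, integral_const_mul,
      integral_indicator_one hA] at h0
    have : P.real A = satProb S N M := rfl
    rw [this] at h0
    linarith
  have := discrim_le_zero key
  rw [discrim] at this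
  linarith

lemma satProb_zero (S : Set ℝ) (N : ℕ) : satProb S N 0 = 1 := by
  have : {X : Fin 0 → Fin N → ℝ | 1 ≤ partitionFunction S X} = Set.univ := by
    ext X
    simp only [partitionFunction, Finset.univ_eq_empty, Finset.prod_empty, Finset.sum_const,
      card_weights, nsmul_eq_mul, mul_one, Set.mem_ofPred_eq, Set.mem_univ, iff_true]
    exact_mod_cast Nat.one_le_two_pow
  rw [satProb, this, probReal_univ]

/-! ### Laplace bound for the second moment -/

lemma integrable_exp_sq_gaussianReal {c : ℝ} (hc : c < 1 / 2) :
    Integrable (fun x => Real.exp (c * x ^ 2)) (gaussianReal 0 1) := by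
  rw [gaussianReal_of_var_ne_zero 0 one_ne_zero,
    integrable_withDensity_iff (measurable_gaussianPDF 0 1)
      (Eventually.of_forall fun _ => gaussianPDF_lt_top)]
  have h := (integrable_exp_neg_mul_sq (b := 1 / 2 - c) (by linarith)).const_mul
    (√(2 * Real.pi))⁻¹
  refine h.congr (Eventually.of_forall fun x => ?_)
  simp only [toReal_gaussianPDF, gaussianPDFReal, NNReal.coe_one, mul_one, sub_zero]
  rw [mul_left_comm, ← Real.exp_add]
  congr 2
  ring

lemma exp_half_sq_eq_integral (a : ℝ) :
    Real.exp (a ^ 2 / 2) = ∫ g, Real.exp (a * g) ∂gaussianReal 0 1 := by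
  have := mgf_gaussianReal (p := gaussianReal 0 1) (X := id) (μ := 0) (v := 1)
    (by simp) a
  rw [mgf] at this
  simpa using this.symm

lemma sum_choose_exp (N : ℕ) (x : ℝ) :
    ∑ l ∈ Finset.range (N + 1), (N.choose l : ℝ) * Real.exp (x * (2 * l - N)) =
      2 ^ N * Real.cosh x ^ N := by
  rw [Real.cosh_eq, ← mul_pow, mul_div_cancel₀ _ two_ne_zero, add_pow]
  refine Finset.sum_congr rfl fun l hl => ?_
  have hl' : l ≤ N := by simpa [Nat.lt_succ_iff] using hl
  rw [← Real.exp_nat_mul, ← Real.exp_nat_mul, ← Real.exp_add, mul_comm, Nat.cast_sub hl']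
  congr 2
  ring

/-- The centred and rescaled binomial law has Gaussian exponential moments of every order below
that of its variance proxy, uniformly in `N`. The exponential of the square is linearized by an
auxiliary Gaussian variable, which makes Stirling's formula unnecessary. -/
lemma exists_binomial_exp_sq_bound {t : ℝ} (ht0 : 0 ≤ t) (ht : t < 2) :
    ∃ C : ℝ, ∀ N : ℕ, N ≠ 0 →
      ∑ l ∈ Finset.range (N + 1),
        (N.choose l : ℝ) * Real.exp (N * (t * ((l : ℝ) / N - 1 / 2) ^ 2)) ≤ C * 2 ^ N := by
  refine ⟨∫ g, Real.exp (t / 4 * g ^ 2) ∂gaussianReal 0 1, fun N hN => ?_⟩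
  have hN' : (0 : ℝ) < N := by exact_mod_cast Nat.pos_of_ne_zero hN
  set s : ℝ := √(t / (2 * N)) with hs
  have hs2 : s ^ 2 = t / (2 * N) := Real.sq_sqrt (by positivity)
  have hint : ∀ a : ℝ, Integrable (fun g => Real.exp (a * g)) (gaussianReal 0 1) :=
    fun a => integrable_exp_mul_gaussianReal a
  have h1 : ∀ l : ℕ, Real.exp (N * (t * ((l : ℝ) / N - 1 / 2) ^ 2)) =
      ∫ g, Real.exp (s * (2 * l - N) * g) ∂gaussianReal 0 1 := by
    intro l
    rw [← exp_half_sq_eq_integral]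
    congr 1
    rw [mul_pow, hs2]
    field_simp
  simp_rw [h1, ← integral_const_mul]
  rw [← integral_finsetSum _ fun l _ => (hint _).const_mul _, ← integral_mul_const]
  refine integral_mono (integrable_finsetSum _ fun l _ => (hint _).const_mul _)
    ((integrable_exp_sq_gaussianReal (by linarith)).mul_const _) fun g => ?_
  have h2 : ∀ l : ℕ, s * (2 * l - N) * g = (s * g) * (2 * l - N) := fun l => by ring
  simp only [h2]
  rw [sum_choose_exp, mul_comm]
  gcongr
  calc Real.cosh (s * g) ^ N ≤ Real.exp ((s * g) ^ 2 / 2) ^ N := by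
        gcongr
        exact Real.cosh_le_exp_half_sq _
    _ = Real.exp (t / 4 * g ^ 2) := by
        rw [← Real.exp_nat_mul, mul_pow, hs2]
        congr 1
        field_simp
        ring

lemma choose_le_exp_binEntropy {N l : ℕ} (hN : N ≠ 0) (hl : l ≤ N) :
    (N.choose l : ℝ) ≤ Real.exp (N * Real.binEntropy ((l : ℝ) / N)) := by
  have hN' : (0 : ℝ) < N := by exact_mod_cast Nat.pos_of_ne_zero hN
  have hpow : ∀ k : ℕ, ((k : ℝ) / N) ^ k = Real.exp (k * Real.log ((k : ℝ) / N)) := by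
    intro k
    rcases Nat.eq_zero_or_pos k with rfl | hk
    · simp
    · have : (0 : ℝ) < (k : ℝ) / N := by positivity
      rw [Real.exp_nat_mul, Real.exp_log this]
  have hsub : 1 - (l : ℝ) / N = ((N - l : ℕ) : ℝ) / N := by
    rw [Nat.cast_sub hl]; field_simp
  have hone : ((l : ℝ) / N) ^ l * (1 - (l : ℝ) / N) ^ (N - l) * (N.choose l : ℝ) ≤ 1 := by
    have h := add_pow ((l : ℝ) / N) (1 - (l : ℝ) / N) N
    rw [add_sub_cancel, one_pow] at h
    refine le_of_le_of_eq ?_ h.symm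
    refine Finset.single_le_sum (f := fun k => ((l : ℝ) / N) ^ k * (1 - (l : ℝ) / N) ^ (N - k) *
      (N.choose k : ℝ)) (fun k _ => ?_) (Finset.mem_range.2 (Nat.lt_succ_of_le hl))
    rw [hsub]; positivity
  have hexp : ((l : ℝ) / N) ^ l * (1 - (l : ℝ) / N) ^ (N - l) =
      Real.exp (-(N * Real.binEntropy ((l : ℝ) / N))) := by
    rw [hsub, hpow, hpow, ← Real.exp_add, ← hsub, Nat.cast_sub hl, Real.binEntropy,
      Real.log_inv, Real.log_inv]
    congr 1
    field_simp
    ring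
  rw [hexp, Real.exp_neg, ← div_eq_inv_mul, div_le_one (Real.exp_pos _)] at hone
  exact hone

/-- Discrete Laplace method: near the centre the pair probability is controlled by the Gaussian
bound, elsewhere by the strict maximality of `F` at `1 / 2`. -/
lemma exists_second_moment_bound {S : Set ℝ} {α t δ : ℝ} (hα : 0 < α) (hp : 0 < p S)
    (hq : ∀ β ∈ Set.Icc (0 : ℝ) 1, p S ^ 2 ≤ q S β)
    (hcont : ContinuousOn (q S) (Set.Icc 0 1)) (ht0 : 0 ≤ t) (ht : t < 2)
    (hδ : 0 < δ)
    (hloc : ∀ β ∈ Set.Icc (0 : ℝ) 1, |β - 1 / 2| < δ →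
      α * Real.log (q S β / p S ^ 2) ≤ t * (β - 1 / 2) ^ 2)
    (hglob : ∀ β ∈ Set.Icc (0 : ℝ) 1, β ≠ 1 / 2 →
      F S α β < Real.log 2 + α * Real.log (p S ^ 2)) :
    ∃ C : ℝ, ∀ N : ℕ, N ≠ 0 →
      ∑ l ∈ Finset.range (N + 1), (N.choose l : ℝ) * q S ((l : ℝ) / N) ^ ⌊α * (N : ℝ)⌋₊ ≤
        C * 2 ^ N * (p S ^ 2) ^ ⌊α * (N : ℝ)⌋₊ := by
  have hp2 : 0 < p S ^ 2 := by positivity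
  have hq0 : ∀ β ∈ Set.Icc (0 : ℝ) 1, 0 < q S β := fun β hβ => hp2.trans_le (hq β hβ)
  obtain ⟨η, hη, hfar⟩ : ∃ η > 0, ∀ β ∈ Set.Icc (0 : ℝ) 1, δ ≤ |β - 1 / 2| →
      F S α β ≤ Real.log 2 + α * Real.log (p S ^ 2) - η := by
    have hcF : ContinuousOn (F S α) (Set.Icc 0 1) := by
      unfold F
      exact Real.binEntropy_continuous.continuousOn.add
        (continuousOn_const.mul (hcont.log fun β hβ => (hq0 β hβ).ne'))
    have hK : IsCompact (Set.Icc (0 : ℝ) 1 ∩ {β | δ ≤ |β - 1 / 2|}) :=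
      isCompact_Icc.inter_right (isClosed_le continuous_const (by fun_prop))
    rcases (Set.Icc (0 : ℝ) 1 ∩ {β | δ ≤ |β - 1 / 2|}).eq_empty_or_nonempty with he | hne
    · refine ⟨1, one_pos, fun β hβ hβ' => ?_⟩
      have : β ∈ (Set.Icc (0 : ℝ) 1 ∩ {β | δ ≤ |β - 1 / 2|}) := ⟨hβ, hβ'⟩
      rw [he] at this
      exact this.elim
    · obtain ⟨b, hb, hmax⟩ := hK.exists_isMaxOn hne (hcF.mono Set.inter_subset_left)
      have hb2 : b ≠ 1 / 2 := by
        rintro rfl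
        have : δ ≤ |(1 / 2 : ℝ) - 1 / 2| := hb.2
        simp at this
        linarith
      refine ⟨Real.log 2 + α * Real.log (p S ^ 2) - F S α b,
        sub_pos.2 (hglob b hb.1 hb2), fun β hβ hβ' => ?_⟩
      have : F S α β ≤ F S α b := hmax ⟨hβ, hβ'⟩
      linarith
  obtain ⟨C, hC⟩ := exists_binomial_exp_sq_bound ht0 ht
  refine ⟨C + (1 + 1 / η), fun N hN => ?_⟩
  have hN' : (0 : ℝ) < N := by exact_mod_cast Nat.pos_of_ne_zero hN
  set M := ⌊α * (N : ℝ)⌋₊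
  have hM : (M : ℝ) ≤ α * N := Nat.floor_le (by positivity)
  have hterm : ∀ l ∈ Finset.range (N + 1),
      (N.choose l : ℝ) * q S ((l : ℝ) / N) ^ M ≤
        ((N.choose l : ℝ) * Real.exp (N * (t * ((l : ℝ) / N - 1 / 2) ^ 2)) +
          2 ^ N * Real.exp (-(η * N))) * (p S ^ 2) ^ M := by
    intro l hl
    have hl' : l ≤ N := by simpa [Nat.lt_succ_iff] using hl
    have hβ : (l : ℝ) / N ∈ Set.Icc (0 : ℝ) 1 :=
      ⟨by positivity, div_le_one_of_le₀ (by exact_mod_cast hl') hN'.le⟩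
    set β := (l : ℝ) / N
    have hf0 : 0 ≤ Real.log (q S β / p S ^ 2) :=
      Real.log_nonneg ((one_le_div hp2).2 (hq β hβ))
    have hqe : q S β ^ M ≤ Real.exp (N * (α * Real.log (q S β / p S ^ 2))) * (p S ^ 2) ^ M := by
      have h1 : q S β ^ M = Real.exp (M * Real.log (q S β / p S ^ 2)) * (p S ^ 2) ^ M := by
        rw [Real.exp_nat_mul, Real.exp_log (div_pos (hq0 β hβ) hp2), ← mul_pow,
          div_mul_cancel₀ _ hp2.ne']
      rw [h1]
      gcongr Real.exp ?_ * _
      calc (M : ℝ) * Real.log (q S β / p S ^ 2) ≤ (α * N) * Real.log (q S β / p S ^ 2) := by gcongr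
        _ = _ := by ring
    refine (mul_le_mul_of_nonneg_left hqe (Nat.cast_nonneg _)).trans ?_
    rw [← mul_assoc]
    gcongr
    by_cases hc : |β - 1 / 2| < δ
    · have h := hloc β hβ hc
      have : (N.choose l : ℝ) * Real.exp (N * (α * Real.log (q S β / p S ^ 2))) ≤
          (N.choose l : ℝ) * Real.exp (N * (t * (β - 1 / 2) ^ 2)) := by gcongr
      have h3 : 0 ≤ 2 ^ N * Real.exp (-(η * N)) := by positivity
      linarith
    · have h := hfar β hβ (not_lt.1 hc)
      rw [F] at h
      have hlog : Real.log (q S β / p S ^ 2) = Real.log (q S β) - Real.log (p S ^ 2) :=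
        Real.log_div (hq0 β hβ).ne' hp2.ne'
      have : (N.choose l : ℝ) * Real.exp (N * (α * Real.log (q S β / p S ^ 2))) ≤
          2 ^ N * Real.exp (-(η * N)) := by
        calc _ ≤ Real.exp (N * Real.binEntropy β) *
              Real.exp (N * (α * Real.log (q S β / p S ^ 2))) := by
              gcongr; exact choose_le_exp_binEntropy hN hl'
          _ = Real.exp (N * (Real.binEntropy β + α * Real.log (q S β / p S ^ 2))) := by
              rw [← Real.exp_add]; ring_nf
          _ ≤ Real.exp (N * (Real.log 2 - η)) := by
              gcongr; rw [hlog]; linarith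
          _ = 2 ^ N * Real.exp (-(η * N)) := by
              rw [mul_sub, Real.exp_sub, Real.exp_nat_mul, Real.exp_log two_pos, Real.exp_neg,
                mul_comm (N : ℝ) η]; rfl
      have h3 : 0 ≤ (N.choose l : ℝ) * Real.exp (N * (t * (β - 1 / 2) ^ 2)) := by positivity
      linarith
  refine (Finset.sum_le_sum hterm).trans ?_
  rw [← Finset.sum_mul, Finset.sum_add_distrib, Finset.sum_const, Finset.card_range, nsmul_eq_mul]
  gcongr
  have hexp : ((N + 1 : ℕ) : ℝ) * Real.exp (-(η * N)) ≤ 1 + 1 / η := by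
    have h1 : η * N + 1 ≤ Real.exp (η * N) := Real.add_one_le_exp _
    rw [Real.exp_neg, ← div_eq_mul_inv, div_le_iff₀ (Real.exp_pos _)]
    calc ((N + 1 : ℕ) : ℝ) ≤ (1 + 1 / η) * (η * N + 1) := by
          push_cast
          have : (1 + 1 / η) * (η * N + 1) = N + 1 + η * N + 1 / η := by field_simp; ring
          rw [this]
          have : 0 ≤ η * N + 1 / η := by positivity
          linarith
      _ ≤ _ := by gcongr
  have := hC N hN
  have h2 : (0 : ℝ) < 2 ^ N := by positivity
  nlinarith [mul_le_mul_of_nonneg_left hexp h2.le]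

/-! ### The capacity from the two moments -/

lemma annealedCapacity_pos {S : Set ℝ} (hp0 : 0 < p S) (hp1 : p S < 1) :
    0 < annealedCapacity S :=
  div_pos_of_neg_of_neg (neg_neg_of_pos (Real.log_pos one_lt_two)) (Real.log_neg hp0 hp1)

lemma tendsto_satProb_zero {S : Set ℝ} (hS : MeasurableSet S) (hp0 : 0 < p S) (hp1 : p S < 1)
    {α : ℝ} (hα : annealedCapacity S < α) :
    Tendsto (fun N : ℕ => satProb S N ⌊α * (N : ℝ)⌋₊) atTop (𝓝 0) := by
  have hlog := Real.log_neg hp0 hp1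
  set c := Real.log 2 + α * Real.log (p S)
  have hc : c < 0 := by
    have : annealedCapacity S * Real.log (p S) = -Real.log 2 := by
      rw [annealedCapacity, div_mul_cancel₀ _ hlog.ne]
    have := mul_lt_mul_of_neg_right hα hlog
    simp only [c]; linarith
  have hlim : Tendsto (fun N : ℕ => (p S)⁻¹ * Real.exp c ^ N) atTop (𝓝 0) := by
    simpa using (tendsto_pow_atTop_nhds_zero_of_lt_one (Real.exp_pos c).le
      (Real.exp_lt_one_iff.2 hc)).const_mul (p S)⁻¹
  refine squeeze_zero' (Eventually.of_forall fun N => measureReal_nonneg) ?_ hlim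
  filter_upwards [eventually_ne_atTop 0] with N hN
  refine (satProb_le hS hN _).trans ?_
  have h1 : α * N - 1 ≤ ⌊α * (N : ℝ)⌋₊ := (Nat.sub_one_lt_floor _).le
  calc (2 : ℝ) ^ N * p S ^ ⌊α * (N : ℝ)⌋₊
      = Real.exp (N * Real.log 2) * Real.exp (⌊α * (N : ℝ)⌋₊ * Real.log (p S)) := by
        rw [Real.exp_nat_mul, Real.exp_nat_mul, Real.exp_log two_pos, Real.exp_log hp0]
    _ ≤ Real.exp (N * Real.log 2) * Real.exp ((α * N - 1) * Real.log (p S)) := by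
        gcongr Real.exp _ * Real.exp ?_
        exact mul_le_mul_of_nonpos_right h1 hlog.le
    _ = (p S)⁻¹ * Real.exp c ^ N := by
        rw [← Real.exp_nat_mul, ← Real.exp_log (inv_pos.2 hp0), Real.log_inv, ← Real.exp_add,
          ← Real.exp_add]
        simp only [c]; ring_nf

/-- The annealed capacity is the storage capacity as soon as the second moment of the partition
function is of the order of the squared first moment at every smaller density. -/
lemma storageCapacity_eq {S : Set ℝ} (hS : MeasurableSet S) (hp0 : 0 < p S) (hp1 : p S < 1)
    (h : ∀ α : ℝ, 0 < α → α < annealedCapacity S → ∃ C : ℝ, ∀ N : ℕ, N ≠ 0 →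
      ∑ l ∈ Finset.range (N + 1), (N.choose l : ℝ) * q S ((l : ℝ) / N) ^ ⌊α * (N : ℝ)⌋₊ ≤
        C * 2 ^ N * (p S ^ 2) ^ ⌊α * (N : ℝ)⌋₊) :
    storageCapacity S = annealedCapacity S := by
  have hpos := annealedCapacity_pos hp0 hp1
  refine csInf_eq_of_forall_ge_of_forall_gt_exists_lt
    ⟨annealedCapacity S + 1, by positivity, tendsto_satProb_zero hS hp0 hp1 (by linarith)⟩ ?_ ?_
  · rintro α ⟨hα0, hα⟩
    by_contra hlt
    push Not at hlt
    rcases hα0.eq_or_lt with rfl | hα0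
    · simp only [zero_mul, Nat.floor_zero, satProb_zero] at hα
      exact one_ne_zero (tendsto_nhds_unique tendsto_const_nhds hα)
    · obtain ⟨C, hC⟩ := h α hα0 hlt
      have hge : ∀ N : ℕ, N ≠ 0 → 1 ≤ C * satProb S N ⌊α * (N : ℝ)⌋₊ := by
        intro N hN
        have h1 := sq_first_moment_le hS hN ⌊α * (N : ℝ)⌋₊
        have hs0 : 0 ≤ satProb S N ⌊α * (N : ℝ)⌋₊ := measureReal_nonneg
        have h2 := mul_le_mul_of_nonneg_left (hC N hN)
          (mul_nonneg (hs0 : 0 ≤ satProb S N ⌊α * (N : ℝ)⌋₊)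
            (pow_nonneg two_pos.le N : (0 : ℝ) ≤ 2 ^ N))
        have h3 : (0 : ℝ) < (2 ^ N * p S ^ ⌊α * (N : ℝ)⌋₊) ^ 2 := by positivity
        have h4 : (2 ^ N * p S ^ ⌊α * (N : ℝ)⌋₊) ^ 2 * 1 ≤
            (2 ^ N * p S ^ ⌊α * (N : ℝ)⌋₊) ^ 2 * (C * satProb S N ⌊α * (N : ℝ)⌋₊) := by
          rw [mul_one]
          refine h1.trans ((le_of_eq (mul_assoc _ _ _).symm).trans (h2.trans (le_of_eq ?_)))
          rw [← pow_mul, mul_pow, ← pow_mul, mul_comm 2 ⌊α * (N : ℝ)⌋₊]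
          ring
        exact le_of_mul_le_mul_left h4 h3
      have hlim := hα.const_mul C
      rw [mul_zero] at hlim
      have := ge_of_tendsto hlim ((eventually_ne_atTop 0).mono hge)
      exact absurd this (by norm_num)
  · intro w hw
    obtain ⟨α, h1, h2⟩ := exists_between hw
    exact ⟨α, ⟨(hpos.trans h1).le, tendsto_satProb_zero hS hp0 hp1 h1⟩, h2⟩

/-! ### The pair probability in polar coordinates -/

/-- The standard Gaussian measure of the plane. -/
noncomputable abbrev planeGaussian : Measure (ℝ × ℝ) := (gaussianReal 0 1).prod (gaussianReal 0 1)

lemma planeGaussian_map_rotation (θ : ℝ) :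
    planeGaussian.map (ContinuousLinearMap.rotation θ) = planeGaussian :=
  IsGaussian.map_rotation_eq_self (by simp) θ

lemma measurableSet_rectangle (K : ℝ) : MeasurableSet (rectangle K) :=
  measurableSet_le (by fun_prop) measurable_const

lemma measurableSet_uFunction (K : ℝ) : MeasurableSet (uFunction K) :=
  measurableSet_le measurable_const (by fun_prop)

lemma gaussianReal_real_abs_eq (K : ℝ) : (gaussianReal 0 1).real {x | |x| = K} = 0 := by
  have hfin : {x : ℝ | |x| = K} ⊆ {K, -K} := by
    intro x hx
    rcases abs_choice x with h | h <;> simp only [Set.mem_ofPred_eq, h] at hx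
    · left; exact hx
    · right; simp; linarith
  have : NullSingletonClass (gaussianReal 0 1) := nullSingletonClass_gaussianReal one_ne_zero
  rw [measureReal_def, measure_mono_null hfin ((Set.toFinite _).measure_zero _)]
  rfl

lemma gaussianReal_real_abs_lt (K : ℝ) :
    (gaussianReal 0 1).real {x | |x| < K} = p (rectangle K) := by
  have h : rectangle K = {x | |x| < K} ∪ {x | |x| = K} := by
    ext x; exact le_iff_lt_or_eq (a := |x|) (b := K)
  rw [p, h, measureReal_union]
  · rw [gaussianReal_real_abs_eq, add_zero]
  · rw [Set.disjoint_left]; intro x hx hx'; exact absurd hx' (ne_of_lt hx)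
  · exact measurableSet_eq_fun (by fun_prop) measurable_const

lemma p_uFunction (K : ℝ) : p (uFunction K) = 1 - p (rectangle K) := by
  have h : uFunction K = {x | |x| < K}ᶜ := by
    ext x; simp [uFunction]
  rw [p, h, probReal_compl_eq_one_sub (measurableSet_lt (by fun_prop) measurable_const),
    gaussianReal_real_abs_lt]

/-- The angle with `cos θ = √β` and `sin θ = √(1 - β)`. -/
noncomputable def angle (β : ℝ) : ℝ := Real.arccos √β

lemma cos_angle {β : ℝ} (hβ : β ∈ Set.Icc (0 : ℝ) 1) : Real.cos (angle β) = √β :=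
  Real.cos_arccos (by linarith [Real.sqrt_nonneg β]) (Real.sqrt_le_one.2 hβ.2)

lemma sin_angle {β : ℝ} (hβ : β ∈ Set.Icc (0 : ℝ) 1) : Real.sin (angle β) = √(1 - β) := by
  rw [angle, Real.sin_arccos, Real.sq_sqrt hβ.1]

lemma planeGaussian_real_preimage_fst (θ : ℝ) {T : Set ℝ} (hT : MeasurableSet T) :
    planeGaussian.real {z | Real.cos θ * z.1 + Real.sin θ * z.2 ∈ T} =
      (gaussianReal 0 1).real T := by
  have h : {z : ℝ × ℝ | Real.cos θ * z.1 + Real.sin θ * z.2 ∈ T} =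
      ContinuousLinearMap.rotation θ ⁻¹' (T ×ˢ Set.univ) := by
    ext z
    simp [ContinuousLinearMap.rotation_apply]
  rw [h, ← map_measureReal_apply (by fun_prop) (hT.prod MeasurableSet.univ),
    planeGaussian_map_rotation, measureReal_prod_prod]
  simp

lemma planeGaussian_real_row {β : ℝ} (hβ : β ∈ Set.Icc (0 : ℝ) 1) {T : Set ℝ}
    (hT : MeasurableSet T) :
    planeGaussian.real {z | √β * z.1 + √(1 - β) * z.2 ∈ T} = (gaussianReal 0 1).real T := by
  simpa only [cos_angle hβ, sin_angle hβ] using planeGaussian_real_preimage_fst (angle β) hT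

lemma planeGaussian_real_row' {β : ℝ} (hβ : β ∈ Set.Icc (0 : ℝ) 1) {T : Set ℝ}
    (hT : MeasurableSet T) :
    planeGaussian.real {z | √β * z.1 - √(1 - β) * z.2 ∈ T} = (gaussianReal 0 1).real T := by
  simpa only [Real.cos_neg, Real.sin_neg, cos_angle hβ, sin_angle hβ, neg_mul, ← sub_eq_add_neg]
    using planeGaussian_real_preimage_fst (-angle β) hT

/-- At overlap `1 / 2` the two Gaussian variables are independent. -/
lemma q_half {S : Set ℝ} (hS : MeasurableSet S) (hsymm : ∀ x, -x ∈ S ↔ x ∈ S) :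
    q S (1 / 2) = p S ^ 2 := by
  have hβ : (1 / 2 : ℝ) ∈ Set.Icc (0 : ℝ) 1 := by norm_num
  have h : {z : ℝ × ℝ | √(1 / 2) * z.1 + √(1 - 1 / 2) * z.2 ∈ S ∧
      √(1 / 2) * z.1 - √(1 - 1 / 2) * z.2 ∈ S} =
      ContinuousLinearMap.rotation (angle (1 / 2)) ⁻¹' (S ×ˢ S) := by
    ext z
    simp only [Set.mem_ofPred_eq, Set.mem_preimage, ContinuousLinearMap.rotation_apply,
      Set.mem_prod, smul_eq_mul, cos_angle hβ, sin_angle hβ]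
    have e : (1 : ℝ) - 1 / 2 = 1 / 2 := by norm_num
    rw [e, ← hsymm (√(1 / 2) * z.1 - √(1 / 2) * z.2)]
    ring_nf
  rw [q, h, ← map_measureReal_apply (by fun_prop) (hS.prod hS)]
  change (Measure.map _ planeGaussian).real _ = _
  rw [planeGaussian_map_rotation, measureReal_prod_prod, p, sq]

/-- Inclusion-exclusion: the two constraint sets are complementary up to a null set. -/
lemma q_uFunction (K : ℝ) {β : ℝ} (hβ : β ∈ Set.Icc (0 : ℝ) 1) :
    q (uFunction K) β = 1 - 2 * p (rectangle K) + q (rectangle K) β := by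
  set f : ℝ × ℝ → ℝ := fun z => √β * z.1 + √(1 - β) * z.2
  set g : ℝ × ℝ → ℝ := fun z => √β * z.1 - √(1 - β) * z.2
  have hf : Measurable f := by fun_prop
  have hg : Measurable g := by fun_prop
  set A := {z | |f z| < K}
  set B := {z | |g z| < K}
  have hA : MeasurableSet A := measurableSet_lt (by fun_prop) measurable_const
  have hB : MeasurableSet B := measurableSet_lt (by fun_prop) measurable_const
  have hlt : MeasurableSet {x : ℝ | |x| < K} := measurableSet_lt (by fun_prop) measurable_const
  have heq : MeasurableSet {x : ℝ | |x| = K} := measurableSet_eq_fun (by fun_prop) measurable_const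
  have hPA : planeGaussian.real A = p (rectangle K) :=
    (planeGaussian_real_row hβ hlt).trans (gaussianReal_real_abs_lt K)
  have hPB : planeGaussian.real B = p (rectangle K) :=
    (planeGaussian_real_row' hβ hlt).trans (gaussianReal_real_abs_lt K)
  have hNA : planeGaussian.real {z | |f z| = K} = 0 :=
    (planeGaussian_real_row hβ heq).trans (gaussianReal_real_abs_eq K)
  have hNB : planeGaussian.real {z | |g z| = K} = 0 :=
    (planeGaussian_real_row' hβ heq).trans (gaussianReal_real_abs_eq K)
  have hcap : q (rectangle K) β = planeGaussian.real (A ∩ B) := by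
    refine measureReal_congr ?_
    have hNA' : ∀ᵐ z ∂planeGaussian, |f z| ≠ K := by
      rw [ae_iff]; simpa using (measureReal_eq_zero_iff).1 hNA
    have hNB' : ∀ᵐ z ∂planeGaussian, |g z| ≠ K := by
      rw [ae_iff]; simpa using (measureReal_eq_zero_iff).1 hNB
    filter_upwards [hNA', hNB'] with z h1 h2
    refine propext ?_
    change (|f z| ≤ K ∧ |g z| ≤ K) ↔ (|f z| < K ∧ |g z| < K)
    rw [le_iff_lt_or_eq, le_iff_lt_or_eq]
    tauto
  have hcompl : q (uFunction K) β = planeGaussian.real (A ∪ B)ᶜ := by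
    rw [q]
    congr 1
    ext z
    simp [uFunction, A, B, f, g]
  have hun := measureReal_union_add_inter (μ := planeGaussian) (s := A) hB
  rw [hcompl, probReal_compl_eq_one_sub (hA.union hB), hcap]
  linarith

/-- The integral of `r e^{-r²/2}` over the radii `r > 0` with `r |h| > K`, for `K > 0`. There are
no such radii for `h = 0`, where the exponential would have the junk value `1`. -/
noncomputable def rayTail (K h : ℝ) : ℝ := if h = 0 then 0 else Real.exp (-K ^ 2 / (2 * h ^ 2))

lemma rayTail_nonneg (K h : ℝ) : 0 ≤ rayTail K h := by
  unfold rayTail; split_ifs <;> positivity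

lemma rayTail_le_one (K h : ℝ) : rayTail K h ≤ 1 := by
  unfold rayTail
  split_ifs
  · exact zero_le_one
  · rw [Real.exp_le_one_iff, neg_div]
    exact neg_nonpos.2 (by positivity)

@[fun_prop]
lemma measurable_rayTail (K : ℝ) : Measurable (rayTail K) := by
  unfold rayTail
  exact Measurable.ite (measurableSet_singleton 0) measurable_const (by fun_prop)

lemma intervalIntegrable_rayTail (K : ℝ) {h : ℝ → ℝ} (hh : Measurable h) (a b : ℝ) :
    IntervalIntegrable (fun x => rayTail K (h x)) volume a b := by
  refine (intervalIntegrable_const (c := (1 : ℝ))).mono_fun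
    ((measurable_rayTail K).comp hh).aestronglyMeasurable (Eventually.of_forall fun x => ?_)
  beta_reduce
  rw [Real.norm_of_nonneg (rayTail_nonneg K _), norm_one]
  exact rayTail_le_one K _

lemma lintegral_Ioi_gaussian_radial (a : ℝ) (ha : 0 ≤ a) :
    ∫⁻ r in Set.Ioi a, ENNReal.ofReal (r * ((2 * Real.pi)⁻¹ * Real.exp (-r ^ 2 / 2))) =
      ENNReal.ofReal ((2 * Real.pi)⁻¹ * Real.exp (-a ^ 2 / 2)) := by
  have hd : ∀ x ∈ Set.Ici a, HasDerivAt (fun r : ℝ => -((2 * Real.pi)⁻¹ * Real.exp (-r ^ 2 / 2)))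
      (x * ((2 * Real.pi)⁻¹ * Real.exp (-x ^ 2 / 2))) x := by
    intro x _
    have h1 : HasDerivAt (fun r : ℝ => -r ^ 2 / 2) (-x) x := by
      have := ((hasDerivAt_pow 2 x).neg).div_const 2
      convert! this using 1
      simp; ring
    convert! (h1.exp.const_mul (2 * Real.pi)⁻¹).neg using 1
    ring
  have hpos : ∀ x ∈ Set.Ioi a, 0 ≤ x * ((2 * Real.pi)⁻¹ * Real.exp (-x ^ 2 / 2)) := fun x hx => by
    have : 0 < x := ha.trans_lt hx
    positivity
  have hlim : Tendsto (fun r : ℝ => -((2 * Real.pi)⁻¹ * Real.exp (-r ^ 2 / 2))) atTop (𝓝 0) := by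
    have h1 : Tendsto (fun r : ℝ => -r ^ 2 / 2) atTop atBot := by
      exact (tendsto_neg_atTop_atBot.comp
        (tendsto_pow_atTop (α := ℝ) two_ne_zero)).atBot_div_const (r := 2) two_pos
    have := ((Real.tendsto_exp_atBot.comp h1).const_mul (2 * Real.pi)⁻¹).neg
    simpa using this
  have hint := integrableOn_Ioi_deriv_of_nonneg' hd hpos hlim
  rw [← ofReal_integral_eq_lintegral_ofReal hint
    ((ae_restrict_iff' measurableSet_Ioi).2 (Eventually.of_forall hpos)),
    integral_Ioi_of_hasDerivAt_of_tendsto' hd hint hlim]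
  congr 1
  ring

lemma lintegral_ray (K h : ℝ) (hK : 0 < K) (hh : 0 ≤ h) :
    ∫⁻ r in Set.Ioi (0 : ℝ), {r : ℝ | K < r * h}.indicator
      (fun r => ENNReal.ofReal (r * ((2 * Real.pi)⁻¹ * Real.exp (-r ^ 2 / 2)))) r =
      ENNReal.ofReal ((2 * Real.pi)⁻¹ * rayTail K h) := by
  rcases hh.eq_or_lt with rfl | hh
  · simp [rayTail, not_lt.2 hK.le]
  · have hset : {r : ℝ | K < r * h} = Set.Ioi (K / h) := by
      ext r; simp [div_lt_iff₀ hh]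
    have hsub : Set.Ioi (K / h) ∩ Set.Ioi 0 = Set.Ioi (K / h) :=
      Set.inter_eq_left.2 (Set.Ioi_subset_Ioi (by positivity))
    rw [hset, lintegral_indicator measurableSet_Ioi, Measure.restrict_restrict measurableSet_Ioi,
      hsub, lintegral_Ioi_gaussian_radial _ (by positivity), rayTail, if_neg hh.ne']
    congr 3
    field_simp

/-- The Gaussian measure of the complement of the rhombus `c |x| + s |y| ≤ K`, in polar
coordinates. -/
lemma planeGaussian_real_rhombus_compl {K c s : ℝ} (hK : 0 < K) (hc : 0 ≤ c) (hs : 0 ≤ s) :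
    planeGaussian.real {z | K < c * |z.1| + s * |z.2|} =
      (2 * Real.pi)⁻¹ * ∫ φ in (-Real.pi)..Real.pi,
        rayTail K (c * |Real.cos φ| + s * |Real.sin φ|) := by
  set T := {z : ℝ × ℝ | K < c * |z.1| + s * |z.2|}
  have hT : MeasurableSet T := measurableSet_lt measurable_const (by fun_prop)
  set D : ℝ × ℝ → ENNReal := fun z =>
    ENNReal.ofReal ((2 * Real.pi)⁻¹ * Real.exp (-(z.1 ^ 2 + z.2 ^ 2) / 2))
  have hD : Measurable D := by fun_prop
  have hdens : planeGaussian = (volume : Measure (ℝ × ℝ)).withDensity D := by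
    rw [planeGaussian, gaussianReal_of_var_ne_zero 0 one_ne_zero,
      prod_withDensity (measurable_gaussianPDF 0 1) (measurable_gaussianPDF 0 1)]
    congr 1
    ext z
    simp only [gaussianPDF, D]
    rw [← ENNReal.ofReal_mul (gaussianPDFReal_nonneg 0 1 _)]
    congr 1
    simp only [gaussianPDFReal, NNReal.coe_one, mul_one, sub_zero]
    rw [mul_mul_mul_comm, ← Real.exp_add, ← mul_inv, Real.mul_self_sqrt (by positivity)]
    congr 2
    ring
  have hmeas : planeGaussian T = ENNReal.ofReal ((2 * Real.pi)⁻¹ *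
      ∫ φ in (-Real.pi)..Real.pi, rayTail K (c * |Real.cos φ| + s * |Real.sin φ|)) := by
    rw [hdens, withDensity_apply _ hT, ← lintegral_indicator hT, ← lintegral_comp_polarCoord_symm,
      polarCoord_target, Measure.volume_eq_prod, ← Measure.prod_restrict]
    have hpt : ∀ z : ℝ × ℝ, ENNReal.ofReal z.1 • T.indicator D (polarCoord.symm z) =
        ENNReal.ofReal z.1 *
          {z : ℝ × ℝ | K < |z.1| * (c * |Real.cos z.2| + s * |Real.sin z.2|)}.indicator
          (fun z => ENNReal.ofReal ((2 * Real.pi)⁻¹ * Real.exp (-z.1 ^ 2 / 2))) z := by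
      intro z
      rw [smul_eq_mul]
      congr 1
      have e1 : polarCoord.symm z ∈ T ↔
          z ∈ {z : ℝ × ℝ | K < |z.1| * (c * |Real.cos z.2| + s * |Real.sin z.2|)} := by
        simp only [T, Set.mem_ofPred_eq, polarCoord_symm_apply, abs_mul]
        ring_nf
      have e2 : D (polarCoord.symm z) =
          ENNReal.ofReal ((2 * Real.pi)⁻¹ * Real.exp (-z.1 ^ 2 / 2)) := by
        simp only [D, polarCoord_symm_apply]
        congr 3
        linear_combination (-z.1 ^ 2 / 2) * Real.sin_sq_add_cos_sq z.2
      by_cases h : polarCoord.symm z ∈ T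
      · rw [Set.indicator_of_mem h, Set.indicator_of_mem (e1.1 h), e2]
      · rw [Set.indicator_of_notMem h, Set.indicator_of_notMem (fun h' => h (e1.2 h'))]
    simp_rw [hpt]
    rw [lintegral_prod_symm]
    · have hin : ∀ φ : ℝ, ∫⁻ r in Set.Ioi (0 : ℝ), ENNReal.ofReal r *
          {z : ℝ × ℝ | K < |z.1| * (c * |Real.cos z.2| + s * |Real.sin z.2|)}.indicator
          (fun z => ENNReal.ofReal ((2 * Real.pi)⁻¹ * Real.exp (-z.1 ^ 2 / 2))) (r, φ) =
          ENNReal.ofReal ((2 * Real.pi)⁻¹ * rayTail K (c * |Real.cos φ| + s * |Real.sin φ|)) := by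
        intro φ
        rw [← lintegral_ray K _ hK (by positivity)]
        refine setLIntegral_congr_fun measurableSet_Ioi fun r hr => ?_
        have hr' : (0 : ℝ) < r := hr
        simp only [Set.indicator, Set.mem_ofPred_eq, abs_of_pos hr']
        split_ifs
        · rw [ENNReal.ofReal_mul hr'.le]
        · rw [mul_zero]
      simp_rw [hin]
      rw [← intervalIntegral.integral_const_mul,
        intervalIntegral.integral_of_le (by linarith [Real.pi_pos]),
        integral_Ioc_eq_integral_Ioo, ofReal_integral_eq_lintegral_ofReal]
      · have h1 := ((intervalIntegrable_rayTail K
          (h := fun φ => c * |Real.cos φ| + s * |Real.sin φ|)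
          (by fun_prop) (-Real.pi) Real.pi).const_mul (2 * Real.pi)⁻¹).1
        exact h1.mono_set Set.Ioo_subset_Ioc_self
      · exact Eventually.of_forall fun φ => mul_nonneg (by positivity) (rayTail_nonneg K _)
    · refine Measurable.aemeasurable ?_
      refine (by fun_prop : Measurable fun z : ℝ × ℝ => ENNReal.ofReal z.1).mul ?_
      exact Measurable.indicator (by fun_prop) (measurableSet_lt measurable_const (by fun_prop))
  rw [measureReal_def, hmeas, ENNReal.toReal_ofReal]
  refine mul_nonneg (by positivity) ?_
  exact intervalIntegral.integral_nonneg (by linarith [Real.pi_pos]) fun _ _ => rayTail_nonneg K _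

lemma abs_add_le_and_abs_sub_le_iff {a b K : ℝ} :
    (|a + b| ≤ K ∧ |a - b| ≤ K) ↔ |a| + |b| ≤ K := by
  constructor
  · rintro ⟨h1, h2⟩
    rw [abs_le] at h1 h2
    rcases abs_cases a with ⟨ha, _⟩ | ⟨ha, _⟩ <;> rcases abs_cases b with ⟨hb, _⟩ | ⟨hb, _⟩ <;>
      rw [ha, hb] <;> linarith
  · intro h
    exact ⟨(abs_add_le a b).trans h, (abs_sub a b).trans h⟩

/-- Folding the full circle onto the first quadrant. -/
lemma integral_circle_eq {G : ℝ → ℝ} (hG : ∀ a b : ℝ, IntervalIntegrable G volume a b)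
    (heven : ∀ x, G (-x) = G x) (hrefl : ∀ x, G (Real.pi - x) = G x) :
    ∫ x in (-Real.pi)..Real.pi, G x = 4 * ∫ x in (0)..(Real.pi / 2), G x := by
  have h1 : ∫ x in (-Real.pi)..0, G x = ∫ x in (0)..Real.pi, G x := by
    have := intervalIntegral.integral_comp_neg (a := 0) (b := Real.pi) G
    simp only [heven, neg_zero] at this
    exact this.symm
  have h2 : ∫ x in (Real.pi / 2)..Real.pi, G x = ∫ x in (0)..(Real.pi / 2), G x := by
    have := intervalIntegral.integral_comp_sub_left (a := 0) (b := Real.pi / 2) G Real.pi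
    simp only [hrefl, sub_zero] at this
    rw [this]
    congr 1
    ring
  rw [← intervalIntegral.integral_add_adjacent_intervals (hG (-Real.pi) 0) (hG 0 Real.pi), h1,
    ← intervalIntegral.integral_add_adjacent_intervals (hG 0 (Real.pi / 2))
      (hG (Real.pi / 2) Real.pi), h2]
  ring

/-- The rectangle pair probability as an integral of a fixed function over an interval of length
`π / 2` that moves with the overlap. -/
lemma q_rectangle_eq {K : ℝ} (hK : 0 < K) {β : ℝ} (hβ : β ∈ Set.Icc (0 : ℝ) 1) :
    q (rectangle K) β = 1 - 2 / Real.pi *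
      ∫ ψ in (-angle β)..(Real.pi / 2 - angle β), rayTail K (Real.cos ψ) := by
  have hset : {z : ℝ × ℝ | √β * z.1 + √(1 - β) * z.2 ∈ rectangle K ∧
      √β * z.1 - √(1 - β) * z.2 ∈ rectangle K} =
      {z : ℝ × ℝ | K < √β * |z.1| + √(1 - β) * |z.2|}ᶜ := by
    ext z
    simp only [rectangle, Set.mem_ofPred_eq, Set.mem_compl_iff, not_lt,
      abs_add_le_and_abs_sub_le_iff, abs_mul, abs_of_nonneg (Real.sqrt_nonneg _)]
  have hT : MeasurableSet {z : ℝ × ℝ | K < √β * |z.1| + √(1 - β) * |z.2|} :=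
    measurableSet_lt measurable_const (by fun_prop)
  rw [q, hset, probReal_compl_eq_one_sub hT]
  change 1 - planeGaussian.real _ = _
  rw [planeGaussian_real_rhombus_compl hK (Real.sqrt_nonneg _) (Real.sqrt_nonneg _),
    integral_circle_eq (fun a b => intervalIntegrable_rayTail K (by fun_prop) a b)
      (fun x => by simp) (fun x => by simp)]
  have h1 : ∫ x in (0)..(Real.pi / 2), rayTail K (√β * |Real.cos x| + √(1 - β) * |Real.sin x|) =
      ∫ x in (0)..(Real.pi / 2), rayTail K (Real.cos (x - angle β)) := by
    refine intervalIntegral.integral_congr fun x hx => ?_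
    rw [Set.uIcc_of_le (by positivity)] at hx
    rw [abs_of_nonneg (Real.cos_nonneg_of_neg_pi_div_two_le_of_le (by linarith [hx.1, Real.pi_pos])
      hx.2),
      abs_of_nonneg (Real.sin_nonneg_of_nonneg_of_le_pi hx.1 (by linarith [hx.2, Real.pi_pos])),
      Real.cos_sub, cos_angle hβ, sin_angle hβ]
    ring_nf
  rw [h1, intervalIntegral.integral_comp_sub_right (fun x => rayTail K (Real.cos x)), zero_sub]
  field_simp
  ring

/-- The primitive of `ψ ↦ rayTail K (cos ψ)` that vanishes at `0`. -/
noncomputable def rayPrimitive (K x : ℝ) : ℝ := ∫ ψ in (0)..x, rayTail K (Real.cos ψ)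

lemma q_rectangle_eq_primitive {K : ℝ} (hK : 0 < K) {β : ℝ} (hβ : β ∈ Set.Icc (0 : ℝ) 1) :
    q (rectangle K) β = 1 - 2 / Real.pi *
      (rayPrimitive K (Real.pi / 2 - angle β) - rayPrimitive K (-angle β)) := by
  rw [q_rectangle_eq hK hβ, rayPrimitive, rayPrimitive,
    intervalIntegral.integral_interval_sub_left] <;>
  exact intervalIntegrable_rayTail K Real.measurable_cos _ _

lemma continuous_rayPrimitive (K : ℝ) : Continuous (rayPrimitive K) :=
  intervalIntegral.continuous_primitive
    (fun a b => intervalIntegrable_rayTail K Real.measurable_cos a b) 0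

lemma rayPrimitive_neg (K x : ℝ) : rayPrimitive K (-x) = -rayPrimitive K x := by
  have h := intervalIntegral.integral_comp_neg (a := 0) (b := x) fun ψ => rayTail K (Real.cos ψ)
  simp only [Real.cos_neg, neg_zero] at h
  rw [rayPrimitive, rayPrimitive, h, intervalIntegral.integral_symm]

lemma continuous_angle : Continuous angle := by
  unfold angle; fun_prop

lemma continuousOn_q_rectangle {K : ℝ} (hK : 0 < K) :
    ContinuousOn (q (rectangle K)) (Set.Icc 0 1) := by
  refine ContinuousOn.congr (Continuous.continuousOn ?_) fun β hβ => q_rectangle_eq_primitive hK hβ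
  have h1 := continuous_rayPrimitive K
  have h2 := continuous_angle
  fun_prop

lemma angle_one_sub {β : ℝ} (hβ : β ∈ Set.Icc (0 : ℝ) 1) :
    angle (1 - β) = Real.pi / 2 - angle β := by
  rw [angle, ← sin_angle hβ, ← Real.cos_pi_div_two_sub]
  refine Real.arccos_cos ?_ ?_
  · have := Real.arccos_le_pi_div_two.2 (Real.sqrt_nonneg β)
    rw [angle]; linarith
  · have := Real.arccos_nonneg √β
    rw [angle]; linarith [Real.pi_pos]

lemma q_rectangle_one_sub {K : ℝ} (hK : 0 < K) {β : ℝ} (hβ : β ∈ Set.Icc (0 : ℝ) 1) :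
    q (rectangle K) (1 - β) = q (rectangle K) β := by
  have hβ' : 1 - β ∈ Set.Icc (0 : ℝ) 1 := ⟨by linarith [hβ.2], by linarith [hβ.1]⟩
  rw [q_rectangle_eq_primitive hK hβ, q_rectangle_eq_primitive hK hβ', angle_one_sub hβ,
    rayPrimitive_neg, rayPrimitive_neg]
  ring_nf

/-- The derivative of the pair probability with respect to the overlap parameter `β`. -/
noncomputable def pairSlope (K β : ℝ) : ℝ :=
  (Real.pi * √(β * (1 - β)))⁻¹ *
    (Real.exp (-K ^ 2 / (2 * β)) - Real.exp (-K ^ 2 / (2 * (1 - β))))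

lemma hasDerivAt_rayPrimitive {K x : ℝ} (hx : Real.cos x ≠ 0) :
    HasDerivAt (rayPrimitive K) (Real.exp (-K ^ 2 / (2 * Real.cos x ^ 2))) x := by
  have hev : (fun ψ => rayTail K (Real.cos ψ)) =ᶠ[𝓝 x]
      fun ψ => Real.exp (-K ^ 2 / (2 * Real.cos ψ ^ 2)) := by
    filter_upwards [Real.continuous_cos.continuousAt.eventually_ne hx] with ψ hψ
    rw [rayTail, if_neg hψ]
  have hcont : ContinuousAt (fun ψ => rayTail K (Real.cos ψ)) x := by
    refine ContinuousAt.congr ?_ hev.symm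
    have : 2 * Real.cos x ^ 2 ≠ 0 := by positivity
    fun_prop (disch := assumption)
  have h := intervalIntegral.integral_hasDerivAt_right
    (intervalIntegrable_rayTail K Real.measurable_cos 0 x)
    ((measurable_rayTail K).comp
      Real.measurable_cos).stronglyMeasurable.stronglyMeasurableAtFilter
    hcont
  rwa [hev.eq_of_nhds] at h

lemma hasDerivAt_q_rectangle {K : ℝ} (hK : 0 < K) {β : ℝ} (hβ : β ∈ Set.Ioo (0 : ℝ) 1) :
    HasDerivAt (q (rectangle K)) (pairSlope K β) β := by
  have hβ' : β ∈ Set.Icc (0 : ℝ) 1 := ⟨hβ.1.le, hβ.2.le⟩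
  have h0 : 0 < √β := Real.sqrt_pos.2 hβ.1
  have h1 : 0 < √(1 - β) := Real.sqrt_pos.2 (by linarith [hβ.2])
  have hang : HasDerivAt angle (-(1 / √(1 - β)) * (1 / (2 * √β))) β := by
    have h2 : √β ≠ 1 := fun h => hβ.2.ne (Real.sqrt_eq_one.1 h)
    have h := (Real.hasDerivAt_arccos (x := √β) (by linarith) h2).comp β
      (Real.hasDerivAt_sqrt hβ.1.ne')
    rw [Real.sq_sqrt hβ.1.le] at h
    exact h
  have hc1 : Real.cos (Real.pi / 2 - angle β) = √(1 - β) := by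
    rw [Real.cos_pi_div_two_sub, sin_angle hβ']
  have hc2 : Real.cos (-angle β) = √β := by rw [Real.cos_neg, cos_angle hβ']
  have d1 := (hasDerivAt_rayPrimitive (K := K) (x := Real.pi / 2 - angle β)
    (by rw [hc1]; exact h1.ne')).comp β (hang.const_sub (Real.pi / 2))
  have d2 := (hasDerivAt_rayPrimitive (K := K) (x := -angle β)
    (by rw [hc2]; exact h0.ne')).comp β hang.neg
  have d := ((d1.sub d2).const_mul (2 / Real.pi)).const_sub 1
  rw [hc1, hc2, Real.sq_sqrt hβ.1.le, Real.sq_sqrt (by linarith [hβ.2])] at d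
  have hev : q (rectangle K) =ᶠ[𝓝 β] fun β => 1 - 2 / Real.pi *
      (rayPrimitive K (Real.pi / 2 - angle β) - rayPrimitive K (-angle β)) := by
    filter_upwards [Ioo_mem_nhds hβ.1 hβ.2] with b hb
    exact q_rectangle_eq_primitive hK ⟨hb.1.le, hb.2.le⟩
  refine HasDerivAt.congr_of_eventuallyEq (HasDerivAt.congr_deriv d ?_) hev
  rw [pairSlope, Real.sqrt_mul hβ.1.le]
  field_simp
  ring

lemma hasDerivAt_pairSlope_half (K : ℝ) :
    HasDerivAt (pairSlope K) (8 * K ^ 2 * Real.exp (-K ^ 2) / Real.pi) (1 / 2) := by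
  have hsq : HasDerivAt (fun β : ℝ => (Real.pi * √(β * (1 - β)))⁻¹)
      (deriv (fun β : ℝ => (Real.pi * √(β * (1 - β)))⁻¹) (1 / 2)) (1 / 2) := by
    refine DifferentiableAt.hasDerivAt ?_
    have h1 : (1 / 2 : ℝ) * (1 - 1 / 2) ≠ 0 := by norm_num
    have h2 : Real.pi * √((1 / 2 : ℝ) * (1 - 1 / 2)) ≠ 0 := by positivity
    fun_prop (disch := assumption)
  have he1 : HasDerivAt (fun β : ℝ => -K ^ 2 / (2 * β)) (2 * K ^ 2) (1 / 2) := by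
    have := (((hasDerivAt_id (1 / 2 : ℝ)).const_mul 2).inv (by norm_num)).const_mul (-K ^ 2)
    refine HasDerivAt.congr_deriv (this.congr_of_eventuallyEq
      (Eventually.of_forall fun β => ?_)) ?_
    · simp [div_eq_mul_inv]
    · norm_num; ring
  have he2 : HasDerivAt (fun β : ℝ => -K ^ 2 / (2 * (1 - β))) (-(2 * K ^ 2)) (1 / 2) := by
    have := ((((hasDerivAt_id (1 / 2 : ℝ)).const_sub 1).const_mul 2).inv (by norm_num)).const_mul
      (-K ^ 2)
    refine HasDerivAt.congr_deriv (this.congr_of_eventuallyEq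
      (Eventually.of_forall fun β => ?_)) ?_
    · simp [div_eq_mul_inv]
    · norm_num; ring
  have h := hsq.mul (he1.exp.sub he2.exp)
  refine HasDerivAt.congr_deriv h ?_
  have hs : √((1 / 2 : ℝ) * (1 - 1 / 2)) = 1 / 2 := by
    rw [show (1 / 2 : ℝ) * (1 - 1 / 2) = (1 / 2) ^ 2 by norm_num]
    exact Real.sqrt_sq (by norm_num)
  simp only [Pi.sub_apply, hs]
  have e1 : -K ^ 2 / (2 * (1 / 2 : ℝ)) = -K ^ 2 := by norm_num
  have e2 : -K ^ 2 / (2 * (1 - 1 / 2 : ℝ)) = -K ^ 2 := by norm_num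
  rw [e1, e2]
  field_simp
  ring

lemma pairSlope_half (K : ℝ) : pairSlope K (1 / 2) = 0 := by
  rw [pairSlope, show (1 : ℝ) - 1 / 2 = 1 / 2 by norm_num, sub_self, mul_zero]

lemma pairSlope_nonneg (K : ℝ) {β : ℝ} (hβ : β ∈ Set.Ioo (1 / 2 : ℝ) 1) : 0 ≤ pairSlope K β := by
  have h1 : 0 < 1 - β := by linarith [hβ.2]
  refine mul_nonneg (by positivity) (sub_nonneg.2 (Real.exp_le_exp.2 ?_))
  rw [neg_div, neg_div, neg_le_neg_iff]
  have : 1 - β ≤ β := by linarith [hβ.1]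
  gcongr

/-! ### Maximality of the second moment entropy at overlap one half -/

/-- A function with a strict local maximum value at `a`, a smaller value at `b` and at most one
critical point in between stays below its value at `a`: otherwise it would have a local minimum
followed by a local maximum. -/
lemma lt_of_unique_critical_point {f : ℝ → ℝ} {a b : ℝ}
    (hf : ContinuousOn f (Set.Icc a b)) (hb : f b < f a)
    (hloc : ∀ᶠ x in 𝓝[>] a, f x < f a)
    (huniq : ∀ x ∈ Set.Ioo a b, ∀ y ∈ Set.Ioo a b, deriv f x = 0 → deriv f y = 0 → x = y) :
    ∀ x ∈ Set.Ioc a b, f x < f a := by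
  intro x hx
  by_contra hge
  push Not at hge
  have hxb : x < b := lt_of_le_of_ne hx.2 (by rintro rfl; linarith)
  obtain ⟨y, hyloc, hy⟩ := (hloc.and (Ioo_mem_nhdsGT hx.1)).exists
  -- an interior minimum of `f` on `[a, x]`
  obtain ⟨m, hm, hmin⟩ := isCompact_Icc.exists_isMinOn (Set.nonempty_Icc.2 hx.1.le)
    (hf.mono (Set.Icc_subset_Icc_right hx.2))
  have hmy : f m ≤ f y := hmin ⟨hy.1.le, hy.2.le⟩
  have hma : m ≠ a := by rintro rfl; linarith
  have hmx : m ≠ x := by rintro rfl; linarith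
  have hmI : m ∈ Set.Ioo a x := ⟨lt_of_le_of_ne hm.1 hma.symm, lt_of_le_of_ne hm.2 hmx⟩
  have hdm : deriv f m = 0 :=
    (hmin.isLocalMin (Icc_mem_nhds hmI.1 hmI.2)).deriv_eq_zero
  -- an interior maximum of `f` on `[m, b]`
  obtain ⟨M, hM, hmax⟩ := isCompact_Icc.exists_isMaxOn (Set.nonempty_Icc.2 (hmI.2.le.trans hx.2))
    (hf.mono (Set.Icc_subset_Icc_left hm.1))
  have hxM : f x ≤ f M := hmax ⟨hmI.2.le, hx.2⟩
  have hMm : M ≠ m := by rintro rfl; linarith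
  have hMb : M ≠ b := by rintro rfl; linarith
  have hMI : M ∈ Set.Ioo m b := ⟨lt_of_le_of_ne hM.1 hMm.symm, lt_of_le_of_ne hM.2 hMb⟩
  have hdM : deriv f M = 0 :=
    (hmax.isLocalMax (Icc_mem_nhds hMI.1 hMI.2)).deriv_eq_zero
  exact hMm (huniq M ⟨hmI.1.trans hMI.1, hMI.2⟩ m ⟨hmI.1, hmI.2.trans hxb⟩ hdM hdm)

/-- The second derivative test, for a derivative that is known near the point only. -/
lemma eventually_nonneg_of_second_deriv_pos {g g' : ℝ → ℝ} {x c : ℝ} (h0 : g x = 0)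
    (hg : ∀ᶠ y in 𝓝 x, HasDerivAt g (g' y) y) (hx : g' x = 0) (hg' : HasDerivAt g' c x)
    (hc : 0 < c) : ∀ᶠ y in 𝓝 x, 0 ≤ g y := by
  have he : deriv g =ᶠ[𝓝 x] g' := hg.mono fun y hy => hy.deriv
  have h1 : deriv (deriv g) x = c := by rw [he.deriv_eq, hg'.deriv]
  have h2 := isLocalMin_of_deriv_deriv_pos (f := g) (x₀ := x) (by rw [h1]; exact hc)
    (by rw [he.eq_of_nhds, hx]) hg.self_of_nhds.continuousAt
  rwa [IsLocalMin, IsMinFilter, h0] at h2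

lemma binEntropy_half : Real.binEntropy (1 / 2) = Real.log 2 := by
  rw [one_div, Real.binEntropy_two_inv]

lemma hasDerivAt_binEntropy_deriv_half :
    HasDerivAt (fun β : ℝ => Real.log (1 - β) - Real.log β) (-4) (1 / 2) := by
  have h := (((hasDerivAt_id (1 / 2 : ℝ)).const_sub 1).log (by norm_num)).sub
    ((hasDerivAt_id (1 / 2 : ℝ)).log (by norm_num))
  refine h.congr_deriv ?_
  norm_num

/-- The second moment method for a constraint set whose pair probability has the slope
`pairSlope`: the annealed capacity is attained if the second derivative of the entropy at `1 / 2`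
does not become positive before it. -/
theorem storageCapacity_eq_of_pairSlope {S : Set ℝ} {K : ℝ} (hS : MeasurableSet S)
    (hp0 : 0 < p S) (hp1 : p S < 1) (hcont : ContinuousOn (q S) (Set.Icc 0 1))
    (hrefl : ∀ β ∈ Set.Icc (0 : ℝ) 1, q S (1 - β) = q S β) (hhalf : q S (1 / 2) = p S ^ 2)
    (hder : ∀ β ∈ Set.Ioo (0 : ℝ) 1, HasDerivAt (q S) (pairSlope K β) β)
    (hcurv : annealedCapacity S * (8 * K ^ 2 * Real.exp (-K ^ 2) / Real.pi / p S ^ 2) ≤ 4)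
    (hK : K ≠ 0)
    (hnum : NumericalHypothesis S) :
    storageCapacity S = annealedCapacity S := by
  refine storageCapacity_eq hS hp0 hp1 fun α hα0 hα => ?_
  have hp2 : 0 < p S ^ 2 := by positivity
  set κ := 8 * K ^ 2 * Real.exp (-K ^ 2) / Real.pi / p S ^ 2 with hκ
  have hκ0 : 0 < κ := by positivity
  have hακ : α * κ < 4 := (mul_lt_mul_of_pos_right hα hκ0).trans_le hcurv
  have hlogp := Real.log_neg hp0 hp1
  -- the pair probability is smallest at overlap `1 / 2`
  have hq' : ∀ β ∈ Set.Icc (1 / 2 : ℝ) 1, p S ^ 2 ≤ q S β := by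
    intro β hβ
    rw [← hhalf]
    refine monotoneOn_of_deriv_nonneg (convex_Icc (1 / 2 : ℝ) 1)
      (hcont.mono (Set.Icc_subset_Icc_left (by norm_num))) ?_ ?_
      (Set.left_mem_Icc.2 (by norm_num)) hβ hβ.1
    · rw [interior_Icc]
      exact fun b hb => (hder b ⟨by linarith [hb.1], hb.2⟩).differentiableAt.differentiableWithinAt
    · rw [interior_Icc]
      intro b hb
      rw [(hder b ⟨by linarith [hb.1], hb.2⟩).deriv]
      exact pairSlope_nonneg K hb
  have hq : ∀ β ∈ Set.Icc (0 : ℝ) 1, p S ^ 2 ≤ q S β := by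
    intro β hβ
    rcases le_total (1 / 2) β with h | h
    · exact hq' β ⟨h, hβ.2⟩
    · rw [← hrefl β hβ]
      exact hq' _ ⟨by linarith, by linarith [hβ.1]⟩
  have hq0 : ∀ β ∈ Set.Icc (0 : ℝ) 1, 0 < q S β := fun β hβ => hp2.trans_le (hq β hβ)
  have hnhds : ∀ᶠ β in 𝓝 (1 / 2 : ℝ), β ∈ Set.Ioo (0 : ℝ) 1 :=
    Ioo_mem_nhds (by norm_num) (by norm_num)
  -- first and second derivatives of the logarithm of the pair probability
  have hlog1 : ∀ β ∈ Set.Ioo (0 : ℝ) 1,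
      HasDerivAt (fun β => Real.log (q S β)) (pairSlope K β / q S β) β := fun β hβ =>
    (hder β hβ).log (hq0 β ⟨hβ.1.le, hβ.2.le⟩).ne'
  have hlog2 : HasDerivAt (fun β => pairSlope K β / q S β) κ (1 / 2) := by
    have h := (hasDerivAt_pairSlope_half K).div (hder (1 / 2) (by norm_num))
      (by rw [hhalf]; exact hp2.ne')
    refine h.congr_deriv ?_
    rw [pairSlope_half, hhalf, hκ]
    field_simp
    ring
  have hslope0 : pairSlope K (1 / 2) / q S (1 / 2) = 0 := by rw [pairSlope_half, zero_div]
  -- first and second derivatives of the entropy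
  have hF1 : ∀ β ∈ Set.Ioo (0 : ℝ) 1, HasDerivAt (F S α)
      (Real.log (1 - β) - Real.log β + α * (pairSlope K β / q S β)) β := fun β hβ =>
    (Real.hasDerivAt_binEntropy hβ.1.ne' hβ.2.ne).add ((hlog1 β hβ).const_mul α)
  have hF2 : HasDerivAt (fun β => Real.log (1 - β) - Real.log β + α * (pairSlope K β / q S β))
      (-4 + α * κ) (1 / 2) := hasDerivAt_binEntropy_deriv_half.add (hlog2.const_mul α)
  have hFhalf : F S α (1 / 2) = Real.log 2 + α * Real.log (p S ^ 2) := by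
    rw [F, binEntropy_half, hhalf]
  have hFone : F S α 1 < F S α (1 / 2) := by
    have h1 := mul_lt_mul_of_neg_right hα hlogp
    rw [annealedCapacity, div_mul_cancel₀ _ hlogp.ne] at h1
    rw [hFhalf, F, Real.binEntropy_one, q_one, Real.log_pow]
    push_cast
    linarith
  have hiter : iteratedDeriv 2 (F S α) (1 / 2) < 0 := by
    have he : deriv (F S α) =ᶠ[𝓝 (1 / 2)]
        fun β => Real.log (1 - β) - Real.log β + α * (pairSlope K β / q S β) :=
      hnhds.mono fun β hβ => (hF1 β hβ).deriv
    rw [iteratedDeriv_succ, iteratedDeriv_one, he.deriv_eq, hF2.deriv]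
    linarith
  obtain ⟨b, -, hb⟩ := hnum α hα0 hα hiter
  -- a quadratic upper bound for the entropy near `1 / 2`
  have hFloc : ∀ᶠ β in 𝓝 (1 / 2 : ℝ),
      0 ≤ F S α (1 / 2) - F S α β - (4 - α * κ) / 4 * (β - 1 / 2) ^ 2 := by
    refine eventually_nonneg_of_second_deriv_pos (c := (4 - α * κ) / 2)
      (g' := fun β => -(Real.log (1 - β) - Real.log β + α * (pairSlope K β / q S β)) -
        (4 - α * κ) / 2 * (β - 1 / 2)) (by ring) ?_ ?_ ?_ (by linarith)
    · filter_upwards [hnhds] with β hβ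
      have h := ((hF1 β hβ).const_sub (F S α (1 / 2))).sub
        ((((hasDerivAt_id β).sub_const (1 / 2)).pow 2).const_mul ((4 - α * κ) / 4))
      refine h.congr_deriv ?_
      simp only [id]
      ring
    · rw [hslope0]
      norm_num
    · have h := hF2.neg.sub (((hasDerivAt_id (1 / 2 : ℝ)).sub_const (1 / 2)).const_mul
        ((4 - α * κ) / 2))
      refine h.congr_deriv ?_
      ring
  have hcF : ContinuousOn (F S α) (Set.Icc 0 1) :=
    Real.binEntropy_continuous.continuousOn.add
      (continuousOn_const.mul (hcont.log fun β hβ => (hq0 β hβ).ne'))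
  have hright : ∀ β ∈ Set.Ioc (1 / 2 : ℝ) 1, F S α β < F S α (1 / 2) := by
    refine lt_of_unique_critical_point (hcF.mono (Set.Icc_subset_Icc_left (by norm_num))) hFone ?_
      fun x hx y hy hdx hdy => (hb x ⟨hx, hdx⟩).trans (hb y ⟨hy, hdy⟩).symm
    filter_upwards [nhdsWithin_le_nhds hFloc, self_mem_nhdsWithin] with β hβ hβ'
    have h1 : 0 < (β - 1 / 2) ^ 2 := by
      have : 0 < β - 1 / 2 := sub_pos.2 hβ'
      positivity
    have h2 : 0 < (4 - α * κ) / 4 * (β - 1 / 2) ^ 2 := mul_pos (by linarith) h1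
    linarith
  have hglob : ∀ β ∈ Set.Icc (0 : ℝ) 1, β ≠ 1 / 2 →
      F S α β < Real.log 2 + α * Real.log (p S ^ 2) := by
    intro β hβ hne
    rw [← hFhalf]
    rcases lt_or_gt_of_ne hne with h | h
    · have hsym : F S α β = F S α (1 - β) := by
        rw [F, F, Real.binEntropy_one_sub, hrefl β hβ]
      rw [hsym]
      exact hright _ ⟨by linarith, by linarith [hβ.1]⟩
    · exact hright β ⟨h, hβ.2⟩
  -- a quadratic bound with `t` strictly between `α κ / 2` and `2`
  set t := (α * κ / 2 + 2) / 2 with ht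
  have ht2 : t < 2 := by rw [ht]; linarith
  have ht0 : 0 ≤ t := by positivity
  have hqloc : ∀ᶠ β in 𝓝 (1 / 2 : ℝ),
      0 ≤ t * (β - 1 / 2) ^ 2 - α * (Real.log (q S β) - Real.log (p S ^ 2)) := by
    refine eventually_nonneg_of_second_deriv_pos (c := 2 * t - α * κ)
      (g' := fun β => 2 * t * (β - 1 / 2) - α * (pairSlope K β / q S β)) ?_ ?_ ?_ ?_
      (by rw [ht]; linarith)
    · rw [hhalf]; ring
    · filter_upwards [hnhds] with β hβ
      have h := ((((hasDerivAt_id β).sub_const (1 / 2)).pow 2).const_mul t).sub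
        (((hlog1 β hβ).sub_const (Real.log (p S ^ 2))).const_mul α)
      refine h.congr_deriv ?_
      simp only [id]
      ring
    · rw [hslope0]
      norm_num
    · have h := (((hasDerivAt_id (1 / 2 : ℝ)).sub_const (1 / 2)).const_mul (2 * t)).sub
        (hlog2.const_mul α)
      refine h.congr_deriv ?_
      ring
  obtain ⟨δ, hδ, hδ'⟩ := Metric.eventually_nhds_iff.1 hqloc
  refine exists_second_moment_bound hα0 hp0 hq hcont ht0 ht2 hδ (fun β hβ hβδ => ?_) hglob
  have h := hδ' (y := β) (by rwa [Real.dist_eq])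
  rw [Real.log_div (hq0 β hβ).ne' hp2.ne']
  linarith

/-! ### Constraint sets of the two models -/

/-- The integral `∫_0^K e^{-x²/2} dx`. -/
noncomputable def halfGauss (K : ℝ) : ℝ := ∫ x in (0)..K, Real.exp (-x ^ 2 / 2)

lemma continuous_exp_neg_sq : Continuous fun x : ℝ => Real.exp (-x ^ 2 / 2) := by fun_prop

lemma hasDerivAt_halfGauss (K : ℝ) : HasDerivAt halfGauss (Real.exp (-K ^ 2 / 2)) K :=
  intervalIntegral.integral_hasDerivAt_right (continuous_exp_neg_sq.intervalIntegrable _ _)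
    continuous_exp_neg_sq.stronglyMeasurable.stronglyMeasurableAtFilter
    continuous_exp_neg_sq.continuousAt

lemma strictMono_halfGauss : StrictMono halfGauss :=
  strictMono_of_hasDerivAt_pos hasDerivAt_halfGauss fun _ => Real.exp_pos _

lemma halfGauss_zero : halfGauss 0 = 0 := intervalIntegral.integral_same

lemma halfGauss_pos {K : ℝ} (hK : 0 < K) : 0 < halfGauss K := by
  rw [← halfGauss_zero]; exact strictMono_halfGauss hK

lemma tendsto_halfGauss : Tendsto halfGauss atTop (𝓝 √(Real.pi / 2)) := by
  have h := integral_gaussian_Ioi (1 / 2)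
  have hint : IntegrableOn (fun x : ℝ => Real.exp (-x ^ 2 / 2)) (Set.Ioi 0) := by
    refine ((integrable_exp_neg_mul_sq (b := 1 / 2) (by norm_num)).congr
      (Eventually.of_forall fun x => ?_)).integrableOn
    beta_reduce
    congr 1; ring
  have h2 := intervalIntegral_tendsto_integral_Ioi 0 hint tendsto_id
  have h3 : ∫ x in Set.Ioi (0 : ℝ), Real.exp (-x ^ 2 / 2) = √(Real.pi / 2) := by
    have e : ∀ x : ℝ, -x ^ 2 / 2 = -(1 / 2) * x ^ 2 := fun x => by ring
    simp_rw [e]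
    rw [h, show Real.pi / (1 / 2) = 2 ^ 2 * (Real.pi / 2) by ring, Real.sqrt_mul (by norm_num),
      Real.sqrt_sq (by norm_num), mul_div_cancel_left₀ _ two_ne_zero]
  rw [h3] at h2
  exact h2

lemma halfGauss_lt (K : ℝ) : halfGauss K < √(Real.pi / 2) :=
  (strictMono_halfGauss (lt_add_one K)).trans_le
    (strictMono_halfGauss.monotone.ge_of_tendsto tendsto_halfGauss _)

lemma p_rectangle {K : ℝ} (hK : 0 ≤ K) : p (rectangle K) = √(2 / Real.pi) * halfGauss K := by
  have hset : rectangle K = Set.Icc (-K) K := by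
    ext x; simp [rectangle, abs_le]
  have h1 : ∀ x : ℝ, gaussianPDFReal 0 1 x = (√(2 * Real.pi))⁻¹ * Real.exp (-x ^ 2 / 2) := by
    intro x; simp [gaussianPDFReal]
  have h2 : ∫ x in (-K)..K, Real.exp (-x ^ 2 / 2) = 2 * halfGauss K := by
    have h3 := intervalIntegral.integral_comp_neg (a := 0) (b := K) fun x => Real.exp (-x ^ 2 / 2)
    simp only [neg_sq, neg_zero] at h3
    rw [← intervalIntegral.integral_add_adjacent_intervals
      (continuous_exp_neg_sq.intervalIntegrable (-K) 0)
      (continuous_exp_neg_sq.intervalIntegrable 0 K),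
      ← h3, halfGauss]
    ring
  rw [p, measureReal_def, gaussianReal_apply_eq_integral _ one_ne_zero,
    ENNReal.toReal_ofReal (integral_nonneg fun x => gaussianPDFReal_nonneg 0 1 x), hset,
    integral_Icc_eq_integral_Ioc, ← intervalIntegral.integral_of_le (by linarith)]
  simp_rw [h1]
  rw [intervalIntegral.integral_const_mul, h2, Real.sqrt_mul two_pos.le, Real.sqrt_div two_pos.le]
  have := Real.sq_sqrt two_pos.le
  field_simp
  linear_combination (-halfGauss K) * this

lemma sqrt_two_div_pi_mul : √(2 / Real.pi) * √(Real.pi / 2) = 1 := by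
  rw [← Real.sqrt_mul (by positivity), show 2 / Real.pi * (Real.pi / 2) = 1 by field_simp,
    Real.sqrt_one]

lemma p_rectangle_pos {K : ℝ} (hK : 0 < K) : 0 < p (rectangle K) := by
  rw [p_rectangle hK.le]
  exact mul_pos (by positivity) (halfGauss_pos hK)

lemma p_rectangle_lt_one {K : ℝ} (hK : 0 < K) : p (rectangle K) < 1 := by
  rw [p_rectangle hK.le, ← sqrt_two_div_pi_mul]
  exact mul_lt_mul_of_pos_left (halfGauss_lt K) (by positivity)

/-- The curvature condition for the entropy at `1 / 2`, solved for the density. -/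
lemma annealedCapacity_mul_le {S : Set ℝ} {K : ℝ} (hp0 : 0 < p S) (hp1 : p S < 1)
    (hcurv : 2 * Real.log 2 * K ^ 2 ≤
      Real.pi * p S ^ 2 * Real.exp (K ^ 2) * -Real.log (p S)) :
    annealedCapacity S * (8 * K ^ 2 * Real.exp (-K ^ 2) / Real.pi / p S ^ 2) ≤ 4 := by
  have hlog : 0 < -Real.log (p S) := neg_pos.2 (Real.log_neg hp0 hp1)
  have e : annealedCapacity S * (8 * K ^ 2 * Real.exp (-K ^ 2) / Real.pi / p S ^ 2) =
      4 * (2 * Real.log 2 * K ^ 2 /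
        (Real.pi * p S ^ 2 * Real.exp (K ^ 2) * -Real.log (p S))) := by
    rw [annealedCapacity, Real.exp_neg, ← neg_div_neg_eq (-Real.log 2), neg_neg]
    field_simp
    ring
  rw [e]
  have : 2 * Real.log 2 * K ^ 2 /
      (Real.pi * p S ^ 2 * Real.exp (K ^ 2) * -Real.log (p S)) ≤ 1 :=
    div_le_one_of_le₀ hcurv (by positivity)
  linarith

theorem storageCapacity_rectangle {K : ℝ} (hK : 0 < K)
    (hcurv : 2 * Real.log 2 * K ^ 2 ≤
      Real.pi * p (rectangle K) ^ 2 * Real.exp (K ^ 2) * -Real.log (p (rectangle K)))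
    (hnum : NumericalHypothesis (rectangle K)) :
    storageCapacity (rectangle K) = annealedCapacity (rectangle K) :=
  storageCapacity_eq_of_pairSlope (K := K) (measurableSet_rectangle K) (p_rectangle_pos hK)
    (p_rectangle_lt_one hK) (continuousOn_q_rectangle hK) (fun _ hβ => q_rectangle_one_sub hK hβ)
    (q_half (measurableSet_rectangle K) fun x => by simp [rectangle])
    (fun _ hβ => hasDerivAt_q_rectangle hK hβ)
    (annealedCapacity_mul_le (p_rectangle_pos hK) (p_rectangle_lt_one hK) hcurv) hK.ne' hnum

lemma p_uFunction_pos {K : ℝ} (hK : 0 < K) : 0 < p (uFunction K) := by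
  rw [p_uFunction]; linarith [p_rectangle_lt_one hK]

lemma p_uFunction_lt_one {K : ℝ} (hK : 0 < K) : p (uFunction K) < 1 := by
  rw [p_uFunction]; linarith [p_rectangle_pos hK]

theorem storageCapacity_uFunction {K : ℝ} (hK : 0 < K)
    (hcurv : 2 * Real.log 2 * K ^ 2 ≤
      Real.pi * p (uFunction K) ^ 2 * Real.exp (K ^ 2) * -Real.log (p (uFunction K)))
    (hnum : NumericalHypothesis (uFunction K)) :
    storageCapacity (uFunction K) = annealedCapacity (uFunction K) := by
  refine storageCapacity_eq_of_pairSlope (K := K) (measurableSet_uFunction K) (p_uFunction_pos hK)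
    (p_uFunction_lt_one hK) ?_ (fun β hβ => ?_)
    (q_half (measurableSet_uFunction K) fun x => by simp [uFunction]) (fun β hβ => ?_)
    (annealedCapacity_mul_le (p_uFunction_pos hK) (p_uFunction_lt_one hK) hcurv) hK.ne' hnum
  · exact (continuousOn_const.add (continuousOn_q_rectangle hK)).congr fun β hβ => q_uFunction K hβ
  · rw [q_uFunction K hβ, q_uFunction K ⟨by linarith [hβ.2], by linarith [hβ.1]⟩,
      q_rectangle_one_sub hK hβ]
  · refine ((hasDerivAt_q_rectangle hK hβ).const_add
      (1 - 2 * p (rectangle K))).congr_of_eventuallyEq ?_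
    filter_upwards [Ioo_mem_nhds hβ.1 hβ.2] with b hb
    exact q_uFunction K ⟨hb.1.le, hb.2.le⟩

/-! ### Rational bounds for the Gaussian integral -/

/-- The partial sums of `e^{K²/2} ∫_0^K e^{-x²/2} dx = ∑ K^(2k+1) / (2k+1)‼`. -/
noncomputable def millsSeries (n : ℕ) (K : ℝ) : ℝ :=
  ∑ k ∈ Finset.range n, K ^ (2 * k + 1) / ((2 * k + 1).doubleFactorial : ℝ)

lemma hasDerivAt_millsSeries (n : ℕ) (K : ℝ) :
    HasDerivAt (millsSeries n)
      (1 + K * millsSeries n K - K ^ (2 * n) / ((2 * n - 1).doubleFactorial : ℝ)) K := by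
  induction n with
  | zero =>
    refine (hasDerivAt_const K (0 : ℝ)).congr_of_eventuallyEq
      (Eventually.of_forall fun x => ?_) |>.congr_deriv ?_ <;> simp [millsSeries]
  | succ n ih =>
    have hfun : millsSeries (n + 1) =
        fun x => millsSeries n x + x ^ (2 * n + 1) / ((2 * n + 1).doubleFactorial : ℝ) := by
      ext x; rw [millsSeries, Finset.sum_range_succ, millsSeries]
    rw [hfun]
    refine (ih.add ((hasDerivAt_pow (2 * n + 1) K).div_const _)).congr_deriv ?_
    have hdf : ((2 * n + 1).doubleFactorial : ℝ) =
        (2 * n + 1) * ((2 * n - 1).doubleFactorial : ℝ) := by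
      rcases n with _ | n
      · simp
      · rw [show 2 * (n + 1) + 1 = (2 * n + 1) + 2 by ring, Nat.doubleFactorial_add_two,
          show 2 * (n + 1) - 1 = 2 * n + 1 by omega]
        push_cast; ring
    have hpos : (0 : ℝ) < ((2 * n - 1).doubleFactorial : ℝ) := by
      exact_mod_cast Nat.doubleFactorial_pos _
    have e : 2 * (n + 1) - 1 = 2 * n + 1 := by omega
    rw [e, hdf]
    simp only [Nat.add_sub_cancel]
    push_cast
    field_simp
    ring

lemma hasDerivAt_exp_neg_sq (K : ℝ) :
    HasDerivAt (fun x : ℝ => Real.exp (-x ^ 2 / 2)) (-K * Real.exp (-K ^ 2 / 2)) K := by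
  have h : HasDerivAt (fun x : ℝ => -x ^ 2 / 2) (-K) K := by
    refine (((hasDerivAt_pow 2 K).neg).div_const 2).congr_deriv ?_
    simp; ring
  exact h.exp.congr_deriv (by ring)

lemma millsSeries_mul_exp_le (n : ℕ) {K : ℝ} (hK : 0 ≤ K) :
    millsSeries n K * Real.exp (-K ^ 2 / 2) ≤ halfGauss K := by
  have hd : ∀ x : ℝ, HasDerivAt
      (fun x => halfGauss x - millsSeries n x * Real.exp (-x ^ 2 / 2))
      (x ^ (2 * n) / ((2 * n - 1).doubleFactorial : ℝ) * Real.exp (-x ^ 2 / 2)) x := fun x =>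
    ((hasDerivAt_halfGauss x).sub ((hasDerivAt_millsSeries n x).mul
      (hasDerivAt_exp_neg_sq x))).congr_deriv (by ring)
  have hmono := monotone_of_hasDerivAt_nonneg hd fun x =>
    mul_nonneg (div_nonneg (Even.pow_nonneg (even_two_mul n) x) (Nat.cast_nonneg _))
      (Real.exp_pos _).le
  have h := hmono hK
  have h0 : millsSeries n 0 = 0 := by simp [millsSeries]
  simp only [h0, halfGauss_zero] at h
  linarith

/-- The remainder of the series is at most a multiple of its first omitted term. -/
lemma halfGauss_le_millsSeries (n : ℕ) {c b K : ℝ}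
    (hc : 1 / ((2 * n - 1).doubleFactorial : ℝ) ≤ c * (2 * n + 1 - b ^ 2)) (hc0 : 0 ≤ c)
    (hK : 0 ≤ K) (hKb : K ≤ b) :
    halfGauss K ≤ (millsSeries n K + c * K ^ (2 * n + 1)) * Real.exp (-K ^ 2 / 2) := by
  have hd : ∀ x : ℝ, HasDerivAt
      (fun x => (millsSeries n x + c * x ^ (2 * n + 1)) * Real.exp (-x ^ 2 / 2) - halfGauss x)
      (x ^ (2 * n) * (c * (2 * n + 1 - x ^ 2) - 1 / ((2 * n - 1).doubleFactorial : ℝ)) *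
        Real.exp (-x ^ 2 / 2)) x := fun x => by
    refine ((((hasDerivAt_millsSeries n x).add ((hasDerivAt_pow (2 * n + 1) x).const_mul c)).mul
      (hasDerivAt_exp_neg_sq x)).sub (hasDerivAt_halfGauss x)).congr_deriv ?_
    simp only [Nat.add_sub_cancel, Pi.add_apply]
    push_cast
    ring
  have hmono : MonotoneOn
      (fun x => (millsSeries n x + c * x ^ (2 * n + 1)) * Real.exp (-x ^ 2 / 2) - halfGauss x)
      (Set.Icc 0 b) := by
    refine monotoneOn_of_deriv_nonneg (convex_Icc 0 b)
      (fun x _ => (hd x).continuousAt.continuousWithinAt)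
      (fun x _ => (hd x).differentiableAt.differentiableWithinAt) fun x hx => ?_
    rw [interior_Icc] at hx
    rw [(hd x).deriv]
    have h1 : x ^ 2 ≤ b ^ 2 := by nlinarith [hx.1, hx.2]
    have h2 : c * (2 * n + 1 - b ^ 2) ≤ c * (2 * n + 1 - x ^ 2) := by gcongr
    refine mul_nonneg (mul_nonneg (Even.pow_nonneg (even_two_mul n) x) (by linarith))
      (Real.exp_pos _).le
  have h := hmono ⟨le_rfl, hK.trans hKb⟩ ⟨hK, hKb⟩ hK
  have h0 : millsSeries n 0 = 0 := by simp [millsSeries]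
  simp only [h0, halfGauss_zero] at h
  have : (0 : ℝ) ^ (2 * n + 1) = 0 := by simp
  rw [this] at h
  linarith

lemma millsSeries_eight (K : ℝ) : millsSeries 8 K = K + K ^ 3 / 3 + K ^ 5 / 15 + K ^ 7 / 105 +
    K ^ 9 / 945 + K ^ 11 / 10395 + K ^ 13 / 135135 + K ^ 15 / 2027025 := by
  simp [millsSeries, Finset.sum_range_succ, Nat.doubleFactorial]

/-- The product `e^{K²/2} ∫_0^K e^{-x²/2} dx`. -/
noncomputable def scaledHalfGauss (K : ℝ) : ℝ := halfGauss K * Real.exp (K ^ 2 / 2)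

lemma exp_half_mul_exp_neg_half (K : ℝ) : Real.exp (K ^ 2 / 2) * Real.exp (-K ^ 2 / 2) = 1 := by
  rw [← Real.exp_add]; simp [neg_div]

lemma millsSeries_le (n : ℕ) {K : ℝ} (hK : 0 ≤ K) : millsSeries n K ≤ scaledHalfGauss K := by
  have h := mul_le_mul_of_nonneg_right (millsSeries_mul_exp_le n hK) (Real.exp_pos (K ^ 2 / 2)).le
  rwa [mul_assoc, mul_comm (Real.exp _), exp_half_mul_exp_neg_half, mul_one] at h

lemma scaledHalfGauss_le {K : ℝ} (hK : 0 ≤ K) (hK2 : K ≤ 1.4) :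
    scaledHalfGauss K ≤ millsSeries 8 K + K ^ 17 / 30405375 := by
  have hd : ((2 * 8 - 1).doubleFactorial : ℝ) = 2027025 := by norm_num [Nat.doubleFactorial]
  have h := halfGauss_le_millsSeries 8 (c := 1 / 30405375) (b := 1.4) (K := K)
    (by rw [hd]; norm_num) (by norm_num) hK hK2
  have h := mul_le_mul_of_nonneg_right h (Real.exp_pos (K ^ 2 / 2)).le
  rw [mul_assoc, mul_comm (Real.exp (-K ^ 2 / 2)), exp_half_mul_exp_neg_half, mul_one] at h
  refine h.trans (le_of_eq ?_)
  ring

lemma hasDerivAt_exp_sq (K : ℝ) :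
    HasDerivAt (fun x : ℝ => Real.exp (x ^ 2 / 2)) (K * Real.exp (K ^ 2 / 2)) K := by
  have h : HasDerivAt (fun x : ℝ => x ^ 2 / 2) K K :=
    ((hasDerivAt_pow 2 K).div_const 2).congr_deriv (by simp)
  exact h.exp.congr_deriv (by ring)

lemma hasDerivAt_scaledHalfGauss (K : ℝ) :
    HasDerivAt scaledHalfGauss (1 + K * scaledHalfGauss K) K := by
  refine ((hasDerivAt_halfGauss K).mul (hasDerivAt_exp_sq K)).congr_deriv ?_
  rw [mul_comm (Real.exp (-K ^ 2 / 2)), exp_half_mul_exp_neg_half, scaledHalfGauss]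
  ring

/-! ### Mills ratio and the crossing equation -/

/-- The Gaussian tail integral `∫_K^∞ e^{-x²/2} dx`. -/
noncomputable def gaussTail (K : ℝ) : ℝ := √(Real.pi / 2) - halfGauss K

lemma gaussTail_pos (K : ℝ) : 0 < gaussTail K := sub_pos.2 (halfGauss_lt K)

lemma hasDerivAt_gaussTail (K : ℝ) : HasDerivAt gaussTail (-Real.exp (-K ^ 2 / 2)) K :=
  (hasDerivAt_halfGauss K).const_sub _

lemma tendsto_gaussTail : Tendsto gaussTail atTop (𝓝 0) := by
  have h := tendsto_halfGauss.const_sub √(Real.pi / 2)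
  rwa [sub_self] at h

lemma tendsto_exp_neg_sq : Tendsto (fun x : ℝ => Real.exp (-x ^ 2 / 2)) atTop (𝓝 0) := by
  refine Real.tendsto_exp_atBot.comp ?_
  exact (tendsto_neg_atTop_atBot.comp (tendsto_pow_atTop (α := ℝ) two_ne_zero)).atBot_div_const
    (r := 2) two_pos

/-- A function that decreases to `0` at infinity is positive. -/
lemma pos_of_deriv_neg_of_tendsto {f f' : ℝ → ℝ} (hd : ∀ x, 0 < x → HasDerivAt f (f' x) x)
    (hneg : ∀ x, 0 < x → f' x < 0) (hlim : Tendsto f atTop (𝓝 0)) {x : ℝ} (hx : 0 < x) :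
    0 < f x := by
  have hanti : StrictAntiOn f (Set.Ioi 0) := by
    refine strictAntiOn_of_deriv_neg (convex_Ioi 0)
      (fun y hy => (hd y hy).continuousAt.continuousWithinAt) fun y hy => ?_
    rw [interior_Ioi] at hy
    rw [(hd y hy).deriv]
    exact hneg y hy
  have h1 : f (x + 1) < f x := hanti hx (by simp; linarith) (by linarith)
  refine lt_of_le_of_lt (le_of_tendsto hlim ?_) h1
  filter_upwards [eventually_ge_atTop (x + 1)] with y hy
  exact hanti.antitoneOn (by simp; linarith) (by simp; linarith) hy

/-- The upper bound for the Mills ratio. -/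
lemma gaussTail_mul_lt {K : ℝ} (hK : 0 < K) : K * gaussTail K < Real.exp (-K ^ 2 / 2) := by
  have h := pos_of_deriv_neg_of_tendsto
    (f := fun x => Real.exp (-x ^ 2 / 2) / x - gaussTail x)
    (f' := fun x => -(Real.exp (-x ^ 2 / 2) / x ^ 2)) (fun x hx => ?_) (fun x hx => ?_) ?_ hK
  · beta_reduce at h
    rw [sub_pos, lt_div_iff₀ hK] at h
    linarith
  · refine (((hasDerivAt_exp_neg_sq x).div (hasDerivAt_id x) hx.ne').sub
      (hasDerivAt_gaussTail x)).congr_deriv ?_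
    simp only [id]
    field_simp
    ring
  · have := Real.exp_pos (-x ^ 2 / 2)
    exact neg_neg_of_pos (by positivity)
  · simpa [div_eq_mul_inv] using
      (tendsto_exp_neg_sq.mul tendsto_inv_atTop_zero).sub tendsto_gaussTail

/-- The lower bound for the Mills ratio. -/
lemma lt_gaussTail_mul {K : ℝ} (hK : 0 < K) :
    K * Real.exp (-K ^ 2 / 2) < (1 + K ^ 2) * gaussTail K := by
  have h := pos_of_deriv_neg_of_tendsto
    (f := fun x => gaussTail x - Real.exp (-x ^ 2 / 2) * (x / (1 + x ^ 2)))
    (f' := fun x => -(2 * Real.exp (-x ^ 2 / 2) / (1 + x ^ 2) ^ 2))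
    (fun x hx => ?_) (fun x hx => ?_) ?_ hK
  · beta_reduce at h
    rw [sub_pos, mul_div_assoc', div_lt_iff₀ (by positivity)] at h
    linarith
  · have h1 : (1 : ℝ) + x ^ 2 ≠ 0 := by positivity
    refine ((hasDerivAt_gaussTail x).sub ((hasDerivAt_exp_neg_sq x).mul
      ((hasDerivAt_id x).div (((hasDerivAt_pow 2 x)).const_add 1) h1))).congr_deriv ?_
    simp only [id, Pi.div_apply]
    push_cast
    field_simp
    ring
  · have := Real.exp_pos (-x ^ 2 / 2)
    exact neg_neg_of_pos (by positivity)
  · have hb : Tendsto (fun x : ℝ => Real.exp (-x ^ 2 / 2) * (x / (1 + x ^ 2))) atTop (𝓝 0) := by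
      refine squeeze_zero' ?_ ?_ tendsto_exp_neg_sq
      · filter_upwards [eventually_gt_atTop 0] with x hx
        positivity
      · filter_upwards [eventually_gt_atTop 0] with x hx
        refine mul_le_of_le_one_right (Real.exp_pos _).le ?_
        rw [div_le_one (by positivity)]
        nlinarith [sq_nonneg (x - 1)]
    simpa using tendsto_gaussTail.sub hb

lemma p_uFunction_eq {K : ℝ} (hK : 0 ≤ K) : p (uFunction K) = √(2 / Real.pi) * gaussTail K := by
  rw [p_uFunction, p_rectangle hK, gaussTail, mul_sub, sqrt_two_div_pi_mul]

/-- The function `-log p_u`, extended to all real `K` by the formula with the tail integral. -/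
noncomputable def negLogTail (K : ℝ) : ℝ := -Real.log (√(2 / Real.pi) * gaussTail K)

lemma hasDerivAt_negLogTail (K : ℝ) :
    HasDerivAt negLogTail (Real.exp (-K ^ 2 / 2) / gaussTail K) K := by
  have hT := gaussTail_pos K
  have hc : 0 < √(2 / Real.pi) := by positivity
  refine (((hasDerivAt_gaussTail K).const_mul _).log (mul_pos hc hT).ne').neg.congr_deriv ?_
  field_simp

lemma negLogTail_zero : negLogTail 0 = 0 := by
  rw [negLogTail, gaussTail, halfGauss_zero, sub_zero, sqrt_two_div_pi_mul, Real.log_one, neg_zero]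

lemma negLogTail_pos {K : ℝ} (hK : 0 < K) : 0 < negLogTail K := by
  rw [negLogTail, ← p_uFunction_eq hK.le]
  exact neg_pos.2 (Real.log_neg (p_uFunction_pos hK) (p_uFunction_lt_one hK))

/-- `K h(K) < 2 ∫_0^K h` for the hazard rate `h` of the Gaussian tail; the difference has the
derivative `h (1 - K (h - K))`, positive by the lower bound for the Mills ratio. -/
lemma mul_hazard_lt {K : ℝ} (hK : 0 < K) :
    K * (Real.exp (-K ^ 2 / 2) / gaussTail K) < 2 * negLogTail K := by
  set f : ℝ → ℝ := fun x => 2 * negLogTail x - x * (Real.exp (-x ^ 2 / 2) / gaussTail x) with hf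
  have hd : ∀ x, HasDerivAt f (Real.exp (-x ^ 2 / 2) / gaussTail x ^ 2 *
      ((1 + x ^ 2) * gaussTail x - x * Real.exp (-x ^ 2 / 2))) x := fun x => by
    have hT := gaussTail_pos x
    refine (((hasDerivAt_negLogTail x).const_mul 2).sub ((hasDerivAt_id x).mul
      ((hasDerivAt_exp_neg_sq x).div (hasDerivAt_gaussTail x) hT.ne'))).congr_deriv ?_
    simp only [id, Pi.div_apply]
    field_simp
    ring
  have hmono : StrictMonoOn f (Set.Ici 0) := by
    refine strictMonoOn_of_deriv_pos (convex_Ici 0)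
      (fun x _ => (hd x).continuousAt.continuousWithinAt) fun x hx => ?_
    rw [interior_Ici] at hx
    rw [(hd x).deriv]
    have := gaussTail_pos x
    exact mul_pos (by positivity) (sub_pos.2 (lt_gaussTail_mul hx))
  have h := hmono (Set.self_mem_Ici) hK.le hK
  simp only [hf, negLogTail_zero] at h
  linarith

/-- The ratio `π p_u² e^{K²} (-log p_u) / K²`, which the crossing equation sets to `2 log 2`. -/
noncomputable def crossingRatio (K : ℝ) : ℝ :=
  2 * (gaussTail K * Real.exp (K ^ 2 / 2)) ^ 2 * (negLogTail K / K ^ 2)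

lemma crossingRatio_mul_sq {K : ℝ} (hK : 0 < K) :
    Real.pi * p (uFunction K) ^ 2 * Real.exp (K ^ 2) * -Real.log (p (uFunction K)) =
      crossingRatio K * K ^ 2 := by
  rw [crossingRatio, p_uFunction_eq hK.le, ← negLogTail, mul_pow, mul_pow,
    Real.sq_sqrt (by positivity), ← Real.exp_nat_mul]
  push_cast
  rw [mul_div_cancel₀ _ two_ne_zero]
  field_simp

lemma hasDerivAt_crossingRatio_fst (K : ℝ) :
    HasDerivAt (fun x => gaussTail x * Real.exp (x ^ 2 / 2))
      (Real.exp (K ^ 2 / 2) * (K * gaussTail K - Real.exp (-K ^ 2 / 2))) K :=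
  ((hasDerivAt_gaussTail K).mul (hasDerivAt_exp_sq K)).congr_deriv (by ring)

lemma hasDerivAt_crossingRatio_snd {K : ℝ} (hK : 0 < K) :
    HasDerivAt (fun x => negLogTail x / x ^ 2)
      ((K * (Real.exp (-K ^ 2 / 2) / gaussTail K) - 2 * negLogTail K) / K ^ 3) K := by
  refine ((hasDerivAt_negLogTail K).div (hasDerivAt_pow 2 K) (by positivity)).congr_deriv ?_
  have := gaussTail_pos K
  push_cast
  field_simp

lemma strictAntiOn_crossingRatio : StrictAntiOn crossingRatio (Set.Ioi 0) := by
  have h1 : StrictAntiOn (fun x => gaussTail x * Real.exp (x ^ 2 / 2)) (Set.Ioi 0) := by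
    refine strictAntiOn_of_deriv_neg (convex_Ioi 0)
      (fun x _ => (hasDerivAt_crossingRatio_fst x).continuousAt.continuousWithinAt) fun x hx => ?_
    rw [interior_Ioi] at hx
    rw [(hasDerivAt_crossingRatio_fst x).deriv]
    exact mul_neg_of_pos_of_neg (Real.exp_pos _) (sub_neg.2 (gaussTail_mul_lt hx))
  have h2 : StrictAntiOn (fun x => negLogTail x / x ^ 2) (Set.Ioi 0) := by
    refine strictAntiOn_of_deriv_neg (convex_Ioi 0)
      (fun x hx => (hasDerivAt_crossingRatio_snd hx).continuousAt.continuousWithinAt) fun x hx => ?_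
    rw [interior_Ioi] at hx
    rw [(hasDerivAt_crossingRatio_snd hx).deriv]
    have hx' : (0 : ℝ) < x := hx
    exact div_neg_of_neg_of_pos (sub_neg.2 (mul_hazard_lt hx)) (by positivity)
  intro x hx y hy hxy
  have a1 := h1 hx hy hxy
  have a2 := h2 hx hy hxy
  have hy' : (0 : ℝ) < y := hy
  have a3 : 0 < gaussTail y * Real.exp (y ^ 2 / 2) := mul_pos (gaussTail_pos y) (Real.exp_pos _)
  have a4 : 0 < negLogTail y / y ^ 2 := div_pos (negLogTail_pos hy) (by positivity)
  beta_reduce at a1 a2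
  unfold crossingRatio
  gcongr

lemma continuousOn_crossingRatio : ContinuousOn crossingRatio (Set.Ioi 0) := fun x hx =>
  ((((hasDerivAt_crossingRatio_fst x).pow 2).const_mul 2).mul
    (hasDerivAt_crossingRatio_snd hx)).continuousAt.continuousWithinAt

/-! ### Location of the crossing -/

lemma sqrt_pi_div_two_bounds : 1.2533140 < √(Real.pi / 2) ∧ √(Real.pi / 2) < 1.2533143 := by
  have h1 := Real.pi_gt_d6
  have h2 := Real.pi_lt_d6
  constructor
  · rw [Real.lt_sqrt (by norm_num)]; norm_num at h1 ⊢; linarith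
  · rw [Real.sqrt_lt' (by norm_num)]; norm_num at h2 ⊢; linarith

lemma gaussTail_mul_exp (K : ℝ) :
    gaussTail K * Real.exp (K ^ 2 / 2) =
      √(Real.pi / 2) * Real.exp (K ^ 2 / 2) - scaledHalfGauss K := by
  rw [gaussTail, scaledHalfGauss]; ring

lemma negLogTail_eq (K : ℝ) :
    negLogTail K = Real.log (√(Real.pi / 2) * Real.exp (K ^ 2 / 2) /
      (gaussTail K * Real.exp (K ^ 2 / 2))) := by
  have hc : √(2 / Real.pi) = (√(Real.pi / 2))⁻¹ := eq_inv_of_mul_eq_one_left sqrt_two_div_pi_mul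
  have hT := gaussTail_pos K
  have := Real.exp_pos (K ^ 2 / 2)
  rw [negLogTail, ← Real.log_inv, hc]
  congr 1
  field_simp

lemma le_crossingRatio {K A l : ℝ} (hK : 0 < K) (hA0 : 0 ≤ A) (hl0 : 0 ≤ l)
    (hA : A ≤ √(Real.pi / 2) * Real.exp (K ^ 2 / 2) - scaledHalfGauss K)
    (hl : Real.exp l * (√(Real.pi / 2) * Real.exp (K ^ 2 / 2) - scaledHalfGauss K) ≤
      √(Real.pi / 2) * Real.exp (K ^ 2 / 2)) :
    2 * A ^ 2 * (l / K ^ 2) ≤ crossingRatio K := by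
  have hT : 0 < gaussTail K * Real.exp (K ^ 2 / 2) := mul_pos (gaussTail_pos K) (Real.exp_pos _)
  rw [← gaussTail_mul_exp] at hA hl
  have hl' : l ≤ negLogTail K := by
    rw [negLogTail_eq, Real.le_log_iff_exp_le (by positivity), le_div_iff₀ hT]
    exact hl
  unfold crossingRatio
  gcongr

lemma crossingRatio_le {K A l : ℝ} (hK : 0 < K)
    (hA : √(Real.pi / 2) * Real.exp (K ^ 2 / 2) - scaledHalfGauss K ≤ A)
    (hl : √(Real.pi / 2) * Real.exp (K ^ 2 / 2) ≤
      Real.exp l * (√(Real.pi / 2) * Real.exp (K ^ 2 / 2) - scaledHalfGauss K)) :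
    crossingRatio K ≤ 2 * A ^ 2 * (l / K ^ 2) := by
  have hT : 0 < gaussTail K * Real.exp (K ^ 2 / 2) := mul_pos (gaussTail_pos K) (Real.exp_pos _)
  rw [← gaussTail_mul_exp] at hA hl
  have hl' : negLogTail K ≤ l := by
    rw [negLogTail_eq, Real.log_le_iff_le_exp (by positivity), div_le_iff₀ hT]
    exact hl
  have := negLogTail_pos hK
  unfold crossingRatio
  gcongr

lemma two_log_two_lt_crossingRatio : 2 * Real.log 2 < crossingRatio 0.8165 := by
  obtain ⟨c1, c2⟩ := sqrt_pi_div_two_bounds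
  have ha1 : 1.39561631 ≤ Real.exp ((0.8165 : ℝ) ^ 2 / 2) :=
    le_trans (by norm_num [Finset.sum_range_succ, Nat.factorial])
      (Real.sum_le_exp_of_nonneg (by norm_num : (0 : ℝ) ≤ 0.8165 ^ 2 / 2) 8)
  have ha2 : Real.exp ((0.8165 : ℝ) ^ 2 / 2) ≤ 1.39561633 :=
    (Real.exp_bound' (by norm_num) (by norm_num) (n := 8) (by norm_num)).trans
      (by norm_num [Finset.sum_range_succ, Nat.factorial])
  have hG1 : 1.02462465 ≤ scaledHalfGauss 0.8165 :=
    le_trans (by rw [millsSeries_eight]; norm_num) (millsSeries_le 8 (by norm_num))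
  have hG2 : scaledHalfGauss 0.8165 ≤ 1.02462467 :=
    (scaledHalfGauss_le (by norm_num) (by norm_num)).trans (by rw [millsSeries_eight]; norm_num)
  have he : Real.exp 0.8813 ≤ 2.41405 :=
    (Real.exp_bound' (by norm_num) (by norm_num) (n := 10) (by norm_num)).trans
      (by norm_num [Finset.sum_range_succ, Nat.factorial])
  have hlog := Real.log_two_lt_d9
  refine lt_of_lt_of_le ?_ (le_crossingRatio (A := 0.72451) (l := 0.8813) (by norm_num)
    (by norm_num) (by norm_num) ?_ ?_)
  · norm_num at hlog ⊢; linarith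
  all_goals
    generalize Real.exp ((0.8165 : ℝ) ^ 2 / 2) = a at *
    generalize √(Real.pi / 2) = c at *
    generalize scaledHalfGauss 0.8165 = G at *
    generalize Real.exp 0.8813 = e at *
    have hca1 : 1.2533140 * 1.39561631 ≤ c * a := by gcongr
    have hca2 : c * a ≤ 1.2533143 * 1.39561633 := by gcongr
    generalize c * a = x at *
  · norm_num at hca1 hG2 ⊢; linarith
  · have h0 : 0 ≤ x - G := by norm_num at hca1 hG2 ⊢; linarith
    refine (mul_le_mul_of_nonneg_right he h0).trans ?_
    norm_num at hca2 hG1 ⊢; linarith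

lemma crossingRatio_lt_two_log_two : crossingRatio 0.8175 < 2 * Real.log 2 := by
  obtain ⟨c1, c2⟩ := sqrt_pi_div_two_bounds
  have ha1 : 1.396757 ≤ Real.exp ((0.8175 : ℝ) ^ 2 / 2) :=
    le_trans (by norm_num [Finset.sum_range_succ, Nat.factorial])
      (Real.sum_le_exp_of_nonneg (by norm_num : (0 : ℝ) ≤ 0.8175 ^ 2 / 2) 8)
  have ha2 : Real.exp ((0.8175 : ℝ) ^ 2 / 2) ≤ 1.39675702 :=
    (Real.exp_bound' (by norm_num) (by norm_num) (n := 8) (by norm_num)).trans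
      (by norm_num [Finset.sum_range_succ, Nat.factorial])
  have hG1 : 1.02646251 ≤ scaledHalfGauss 0.8175 :=
    le_trans (by rw [millsSeries_eight]; norm_num) (millsSeries_le 8 (by norm_num))
  have hG2 : scaledHalfGauss 0.8175 ≤ 1.02646253 :=
    (scaledHalfGauss_le (by norm_num) (by norm_num)).trans (by rw [millsSeries_eight]; norm_num)
  have he : 2.4176 ≤ Real.exp 0.8828 :=
    le_trans (by norm_num [Finset.sum_range_succ, Nat.factorial])
      (Real.sum_le_exp_of_nonneg (by norm_num : (0 : ℝ) ≤ 0.8828) 11)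
  have hlog := Real.log_two_gt_d9
  refine lt_of_le_of_lt (crossingRatio_le (A := 0.724115) (l := 0.8828) (by norm_num) ?_ ?_) ?_
  rotate_left 2
  · norm_num at hlog ⊢; linarith
  all_goals
    generalize Real.exp ((0.8175 : ℝ) ^ 2 / 2) = a at *
    generalize √(Real.pi / 2) = c at *
    generalize scaledHalfGauss 0.8175 = G at *
    generalize Real.exp 0.8828 = e at *
    have hca1 : 1.2533140 * 1.396757 ≤ c * a := by gcongr
    have hca2 : c * a ≤ 1.2533143 * 1.39675702 := by gcongr
    generalize c * a = x at *
  · norm_num at hca2 hG1 ⊢; linarith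
  · have h0 : 0 ≤ x - G := by norm_num at hca1 hG2 ⊢; linarith
    refine le_trans ?_ (mul_le_mul_of_nonneg_right he h0)
    norm_num at hca1 hG2 ⊢; linarith

/-- The threshold of the `u`-function model. -/
lemma exists_crossing : ∃ Kstar : ℝ, 0.8165 < Kstar ∧ Kstar < 0.8175 ∧
    crossingRatio Kstar = 2 * Real.log 2 := by
  have hsub : Set.Icc (0.8165 : ℝ) 0.8175 ⊆ Set.Ioi 0 := fun x hx =>
    lt_of_lt_of_le (by norm_num) hx.1
  obtain ⟨x, hx, hx'⟩ := intermediate_value_Ioo' (by norm_num : (0.8165 : ℝ) ≤ 0.8175)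
    (continuousOn_crossingRatio.mono hsub)
    ⟨crossingRatio_lt_two_log_two, two_log_two_lt_crossingRatio⟩
  exact ⟨x, hx.1, hx.2, hx'⟩

lemma crossingEquation_iff {K : ℝ} (hK : 0 < K) :
    CrossingEquation K ↔ crossingRatio K = 2 * Real.log 2 := by
  have h := crossingRatio_mul_sq hK
  have hK2 : 0 < K ^ 2 := by positivity
  unfold CrossingEquation
  constructor
  · intro h'
    have : crossingRatio K * K ^ 2 = 2 * Real.log 2 * K ^ 2 := by linarith
    exact mul_right_cancel₀ hK2.ne' this
  · intro h'
    rw [h'] at h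
    linarith

/-! ### The curvature inequality of the rectangle model -/

/-- The quotient `m(K) = e^{K²/2} ∫_0^K e^{-x²/2} dx / K`. -/
noncomputable def meanGrowth (K : ℝ) : ℝ := scaledHalfGauss K / K

/-- The combination `B = 1 + (K² - 1) m`, which equals `K m'`. -/
noncomputable def growthSlope (K : ℝ) : ℝ := 1 + (K ^ 2 - 1) * meanGrowth K

/-- The function `u = -log p_r`. -/
noncomputable def negLogCenter (K : ℝ) : ℝ := -Real.log (√(2 / Real.pi) * halfGauss K)

lemma meanGrowth_pos {K : ℝ} (hK : 0 < K) : 0 < meanGrowth K :=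
  div_pos (mul_pos (halfGauss_pos hK) (Real.exp_pos _)) hK

lemma hasDerivAt_meanGrowth {K : ℝ} (hK : 0 < K) :
    HasDerivAt meanGrowth (growthSlope K / K) K := by
  refine ((hasDerivAt_scaledHalfGauss K).div (hasDerivAt_id K) hK.ne').congr_deriv ?_
  simp only [id, growthSlope, meanGrowth]
  field_simp
  ring

lemma hasDerivAt_growthSlope {K : ℝ} (hK : 0 < K) :
    HasDerivAt growthSlope (2 * K * meanGrowth K + (K ^ 2 - 1) * (growthSlope K / K)) K := by
  refine ((((hasDerivAt_pow 2 K).sub_const 1).mul (hasDerivAt_meanGrowth hK)).const_add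
    1).congr_deriv ?_
  simp

lemma hasDerivAt_negLogCenter {K : ℝ} (hK : 0 < K) :
    HasDerivAt negLogCenter (-1 / (K * meanGrowth K)) K := by
  have hE := halfGauss_pos hK
  have hc : 0 < √(2 / Real.pi) := by positivity
  refine (((hasDerivAt_halfGauss K).const_mul _).log (mul_pos hc hE).ne').neg.congr_deriv ?_
  have h := exp_half_mul_exp_neg_half K
  rw [neg_div] at h ⊢
  rw [meanGrowth, scaledHalfGauss, mul_div_cancel₀ _ hK.ne']
  field_simp
  linear_combination -h

lemma tendsto_negLogCenter : Tendsto negLogCenter atTop (𝓝 0) := by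
  have h := tendsto_halfGauss.const_mul √(2 / Real.pi)
  rw [sqrt_two_div_pi_mul] at h
  have h2 := ((Real.continuousAt_log one_ne_zero).tendsto.comp h).neg
  rw [Real.log_one, neg_zero] at h2
  exact h2

lemma meanGrowth_ge {K : ℝ} (hK : 0 < K) (n : ℕ) : millsSeries n K / K ≤ meanGrowth K := by
  unfold meanGrowth
  gcongr
  exact millsSeries_le n hK.le

lemma quartic_le_meanGrowth {K : ℝ} (hK : 0 < K) :
    1 + K ^ 2 / 3 + K ^ 4 / 15 + K ^ 6 / 105 + K ^ 8 / 945 ≤ meanGrowth K := by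
  refine le_trans (le_of_eq ?_) (meanGrowth_ge hK 5)
  simp only [millsSeries, Finset.sum_range_succ, Finset.sum_range_zero, Nat.doubleFactorial]
  push_cast
  field_simp
  ring

lemma meanGrowth_le_exp {K : ℝ} (hK : 0 < K) : meanGrowth K ≤ Real.exp (K ^ 2 / 2) := by
  have h : halfGauss K ≤ K := by
    have hanti : Antitone fun x => halfGauss x - x := by
      refine antitone_of_hasDerivAt_nonpos
        (fun x => (hasDerivAt_halfGauss x).sub (hasDerivAt_id x)) fun x => ?_
      have : Real.exp (-x ^ 2 / 2) ≤ 1 := Real.exp_le_one_iff.2 (by nlinarith [sq_nonneg x])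
      simp only [Pi.zero_apply]
      linarith
    have := hanti hK.le
    simp only [halfGauss_zero] at this
    linarith
  rw [meanGrowth, scaledHalfGauss, div_le_iff₀ hK, mul_comm]
  gcongr

/-- Numerical values at the point `1.367`, which separates the two monotonicity arguments. The two
ranges overlap only on a short interval around it, where `log 2 ≤ m² u` is tightest. -/
lemma values_at_split :
    1.93329 ≤ meanGrowth 1.367 ∧ 0.1882 ≤ negLogCenter 1.367 := by
  have hm1 : 1.93329 ≤ meanGrowth 1.367 :=
    le_trans (by rw [millsSeries_eight]; norm_num) (meanGrowth_ge (by norm_num) 8)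
  refine ⟨hm1, ?_⟩
  have hG2 : scaledHalfGauss 1.367 ≤ 2.64283 :=
    (scaledHalfGauss_le (by norm_num) (by norm_num)).trans (by rw [millsSeries_eight]; norm_num)
  have hG0 : 0 < scaledHalfGauss 1.367 := mul_pos (halfGauss_pos (by norm_num)) (Real.exp_pos _)
  have hE : halfGauss 1.367 = scaledHalfGauss 1.367 / Real.exp (1.367 ^ 2 / 2) := by
    rw [scaledHalfGauss, mul_div_cancel_right₀ _ (Real.exp_pos _).ne']
  have hc : √(2 / Real.pi) = (√(Real.pi / 2))⁻¹ := eq_inv_of_mul_eq_one_left sqrt_two_div_pi_mul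
  obtain ⟨c1, -⟩ := sqrt_pi_div_two_bounds
  have he : 2.1088 ≤ Real.exp ((1.367 : ℝ) ^ 2 / 2 - 0.1882) :=
    le_trans (by norm_num [Finset.sum_range_succ, Nat.factorial])
      (Real.sum_le_exp_of_nonneg (by norm_num : (0 : ℝ) ≤ 1.367 ^ 2 / 2 - 0.1882) 10)
  rw [negLogCenter, hE, hc, ← Real.log_inv, Real.le_log_iff_exp_le (by positivity), mul_inv,
    inv_inv, inv_div]
  rw [Real.exp_sub] at he
  have h0 := Real.exp_pos 0.1882
  rw [le_div_iff₀ h0] at he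
  rw [mul_div_assoc', le_div_iff₀ hG0]
  calc Real.exp 0.1882 * scaledHalfGauss 1.367 ≤ Real.exp 0.1882 * 2.64283 := by gcongr
    _ ≤ 1.2533140 * (2.1088 * Real.exp 0.1882) := by norm_num; linarith
    _ ≤ √(Real.pi / 2) * Real.exp (1.367 ^ 2 / 2) := by gcongr

/-- The sign of the derivative of `u - log 2 / m²` on `(0, 1.367]`. -/
lemma two_log_two_mul_growthSlope_le {K : ℝ} (hK : 0 < K) (hK2 : K ≤ 1.367) :
    2 * Real.log 2 * growthSlope K ≤ meanGrowth K ^ 2 := by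
  have hm := quartic_le_meanGrowth hK
  have hL1 := Real.log_two_lt_d9
  have hL0 := Real.log_pos one_lt_two
  rw [growthSlope]
  generalize meanGrowth K = m at *
  generalize Real.log 2 = L at *
  obtain ⟨s, hs⟩ : ∃ s, s = K ^ 2 := ⟨_, rfl⟩
  have hs0 : 0 ≤ s := hs ▸ sq_nonneg K
  have hs1 : s ≤ 1.868689 := by rw [hs]; nlinarith
  have hm : 1 + s / 3 + s ^ 2 / 15 + s ^ 3 / 105 + s ^ 4 / 945 ≤ m := by
    rw [hs]; linarith [hm]
  rw [← hs]
  obtain ⟨P, hP⟩ : ∃ P, P = 1 + s / 3 + s ^ 2 / 15 + s ^ 3 / 105 + s ^ 4 / 945 := ⟨_, rfl⟩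
  rw [← hP] at hm
  have hP1 : 1 ≤ P := by
    have : 0 ≤ s / 3 + s ^ 2 / 15 + s ^ 3 / 105 + s ^ 4 / 945 := by positivity
    rw [hP]; linarith
  have hpoly : 1.3863 * (1 + (s - 1) * P) ≤ P ^ 2 := by
    -- in the variable `u = 1.868689 - s` the coefficients make positivity visible
    obtain ⟨u, hu⟩ : ∃ u, u = 1.868689 - s := ⟨_, rfl⟩
    have hu0 : 0 ≤ u := by linarith
    have hu1 : 0 ≤ 1.868689 - u := by linarith
    have hsu : s = 1.868689 - u := by linarith
    rw [hP, hsu]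
    have h1 := mul_nonneg hu0 hu1
    have h2 := mul_nonneg (pow_nonneg hu0 2) hu1
    have h4 := mul_nonneg (pow_nonneg hu0 4) hu1
    have h6 := mul_nonneg (pow_nonneg hu0 6) hu1
    have h8 := pow_nonneg hu0 8
    have h5 := pow_nonneg hu0 4
    have h7 := pow_nonneg hu0 6
    ring_nf at h1 h2 h4 h6 h8 h5 h7 ⊢
    linarith
  have hP2 : 2 * L * (1 + (s - 1) * P) ≤ P ^ 2 := by
    rcases le_total 0 (1 + (s - 1) * P) with h | h
    · refine le_trans (mul_le_mul_of_nonneg_right ?_ h) hpoly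
      norm_num at hL1 ⊢; linarith
    · nlinarith [sq_nonneg P]
  have hLs : L * (s - 1) ≤ 1 := by
    rcases le_total 0 (s - 1) with h | h
    · nlinarith
    · nlinarith
  nlinarith [mul_nonneg (sub_nonneg.2 hm) (by linarith : 0 ≤ m + P - 2 * (L * (s - 1)))]

lemma hasDerivAt_rectangle_quotient {K : ℝ} (hK : 0 < K) :
    HasDerivAt (fun x => negLogCenter x - Real.log 2 / meanGrowth x ^ 2)
      (-(meanGrowth K ^ 2 - 2 * Real.log 2 * growthSlope K) / (K * meanGrowth K ^ 3)) K := by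
  have hm := meanGrowth_pos hK
  refine ((hasDerivAt_negLogCenter hK).sub ((hasDerivAt_const K (Real.log 2)).div
    ((hasDerivAt_meanGrowth hK).pow 2) (by simpa using hm.ne'))).congr_deriv ?_
  simp only [Pi.pow_apply]
  push_cast
  field_simp
  ring

/-- The function `u - log 2 / m²` decreases on `(0, 1.367]` to a nonnegative value. -/
lemma rectangle_ineq_left {K : ℝ} (hK : 0 < K) (hK2 : K ≤ 1.367) :
    Real.log 2 ≤ meanGrowth K ^ 2 * negLogCenter K := by
  have hanti : AntitoneOn (fun x => negLogCenter x - Real.log 2 / meanGrowth x ^ 2)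
      (Set.Ioc 0 1.367) := by
    refine antitoneOn_of_deriv_nonpos (convex_Ioc 0 1.367)
      (fun x hx => (hasDerivAt_rectangle_quotient hx.1).continuousAt.continuousWithinAt)
      (fun x hx => ?_) (fun x hx => ?_) <;> rw [interior_Ioc] at hx
    · exact (hasDerivAt_rectangle_quotient hx.1).differentiableAt.differentiableWithinAt
    · rw [(hasDerivAt_rectangle_quotient hx.1).deriv, neg_div]
      have := meanGrowth_pos hx.1
      have hx0 := hx.1
      exact neg_nonpos.2 (div_nonneg
        (sub_nonneg.2 (two_log_two_mul_growthSlope_le hx.1 hx.2.le)) (by positivity))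
  have h := hanti (a := K) ⟨hK, hK2⟩ (b := 1.367) ⟨by norm_num, le_rfl⟩ hK2
  obtain ⟨hm, hu⟩ := values_at_split
  have hlog := Real.log_two_lt_d9
  have h1 : Real.log 2 / meanGrowth 1.367 ^ 2 ≤ negLogCenter 1.367 := by
    rw [div_le_iff₀ (by positivity)]
    calc Real.log 2 ≤ 0.1882 * 1.93329 ^ 2 := by norm_num at hlog ⊢; linarith
      _ ≤ _ := by gcongr
  have h2 : Real.log 2 / meanGrowth K ^ 2 ≤ negLogCenter K := by
    beta_reduce at h; linarith
  rwa [div_le_iff₀ (pow_pos (meanGrowth_pos hK) 2), mul_comm] at h2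

/-- Up to a positive factor, the negative of the derivative of `u - 1 / (2 B)`, as a polynomial in
`1 / m` and `K² - 1`. -/
noncomputable def slopeDefect (K : ℝ) : ℝ :=
  (1 / meanGrowth K) ^ 2 + 3 / 2 * (K ^ 2 - 1) * (1 / meanGrowth K) + (K ^ 2 - 1) ^ 2 / 2 -
    (K ^ 2 - 1) - 1

lemma growthSlope_pos {K : ℝ} (hK : 1 ≤ K) : 0 < growthSlope K := by
  have := meanGrowth_pos (by linarith : 0 < K)
  have h : 0 ≤ K ^ 2 - 1 := by nlinarith
  unfold growthSlope
  positivity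

lemma hasDerivAt_sub_inv_growthSlope {K : ℝ} (hK : 1 ≤ K) :
    HasDerivAt (fun x => negLogCenter x - 1 / (2 * growthSlope x))
      (-(meanGrowth K * slopeDefect K / (K * growthSlope K ^ 2))) K := by
  have hK0 : 0 < K := by linarith
  have hm := meanGrowth_pos hK0
  have hB := growthSlope_pos hK
  refine ((hasDerivAt_negLogCenter hK0).sub ((hasDerivAt_const K (1 : ℝ)).div
    ((hasDerivAt_growthSlope hK0).const_mul 2) (by positivity))).congr_deriv ?_
  have hBm : growthSlope K = 1 + (K ^ 2 - 1) * meanGrowth K := rfl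
  rw [slopeDefect]
  generalize growthSlope K = B at *
  generalize meanGrowth K = m at *
  field_simp
  rw [hBm]
  ring

lemma hasDerivAt_slopeDefect {K : ℝ} (hK : 0 < K) :
    HasDerivAt slopeDefect
      ((K ^ 2 * (3 * (1 / meanGrowth K) + 2 * (K ^ 2 - 1) - 2) -
        (2 * (1 / meanGrowth K) + 3 / 2 * (K ^ 2 - 1)) * (1 / meanGrowth K + (K ^ 2 - 1)) *
          (1 / meanGrowth K)) / K) K := by
  have hm := meanGrowth_pos hK
  have hy : HasDerivAt (fun x => 1 / meanGrowth x)
      (-((1 / meanGrowth K + (K ^ 2 - 1)) * (1 / meanGrowth K)) / K) K := by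
    refine ((hasDerivAt_const K (1 : ℝ)).div (hasDerivAt_meanGrowth hK) hm.ne').congr_deriv ?_
    rw [growthSlope]
    field_simp
    ring
  have hx : HasDerivAt (fun x : ℝ => x ^ 2 - 1) (2 * K) K :=
    ((hasDerivAt_pow 2 K).sub_const 1).congr_deriv (by simp)
  refine (((((hy.pow 2).add ((hx.const_mul (3 / 2)).mul hy)).add
    ((hx.pow 2).div_const 2)).sub hx).sub_const 1).congr_deriv ?_
  push_cast
  field_simp
  ring

lemma monotoneOn_slopeDefect : MonotoneOn slopeDefect (Set.Icc 1.367 1.94) := by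
  have hpos : ∀ x ∈ Set.Icc (1.367 : ℝ) 1.94, 0 < x := fun x hx =>
    lt_of_lt_of_le (by norm_num) hx.1
  refine monotoneOn_of_deriv_nonneg (convex_Icc _ _)
    (fun x hx => (hasDerivAt_slopeDefect (hpos x hx)).continuousAt.continuousWithinAt)
    (fun x hx => (hasDerivAt_slopeDefect
      (hpos x (interior_subset hx))).differentiableAt.differentiableWithinAt) fun x hx => ?_
  have hx := interior_subset hx
  have hx0 := hpos x hx
  rw [(hasDerivAt_slopeDefect hx0).deriv]
  refine div_nonneg ?_ hx0.le
  have hm := meanGrowth_pos hx0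
  have hm1 := quartic_le_meanGrowth hx0
  have hm2 := meanGrowth_le_exp hx0
  obtain ⟨t, ht⟩ : ∃ t, t = x ^ 2 - 1 := ⟨_, rfl⟩
  have hxt : x ^ 2 = 1 + t := by linarith
  have ht0 : 0.868 ≤ t := by rw [ht]; nlinarith [hx.1]
  have hy1 : 1 / meanGrowth x ≤ 0.54 := by
    rw [div_le_iff₀ hm]
    have h6 : 0 ≤ x ^ 6 / 105 + x ^ 8 / 945 := by positivity
    have h4 : x ^ 4 = (1 + t) ^ 2 := by rw [← hxt]; ring
    nlinarith
  have hy0 : 0 < 1 / meanGrowth x := by positivity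
  have hy2 : t ≤ 1 → 0.367 ≤ 1 / meanGrowth x := by
    intro h
    rw [le_div_iff₀ hm]
    have h1 : Real.exp (x ^ 2 / 2) ≤ Real.exp 1 := Real.exp_le_exp.2 (by linarith)
    have h2 := Real.exp_one_lt_d9
    norm_num at h2 ⊢
    linarith
  rw [← ht, hxt]
  generalize 1 / meanGrowth x = y at *
  rcases le_total t 1 with h | h
  · have hy3 := hy2 h
    have e2 : (2 * y + 3 / 2 * t) * (y + t) * y ≤ (2 * y + 3 / 2) * (y + 1) * y := by
      gcongr
      linarith
    have e3 : 1.868 * (3 * y + 2 * 0.868 - 2) ≤ (1 + t) * (3 * y + 2 * t - 2) := by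
      have : 0 ≤ 3 * y + 2 * 0.868 - 2 := by norm_num at hy3 ⊢; linarith
      gcongr
      linarith
    nlinarith [mul_nonneg (sub_nonneg.2 hy3) (sub_nonneg.2 hy1)]
  · have e1 : (2 * y + 3 / 2 * t) * (y + t) * y ≤ (2 * 0.54 + 3 / 2 * t) * (0.54 + t) * y := by
      gcongr
    have e2 : (2 * 0.54 + 3 / 2 * t) * (0.54 + t) * y ≤ (1 + t) * (3 * y + 2 * t - 2) := by
      have e3 : 0 ≤ (1 + t) * (2 * t - 2) := mul_nonneg (by linarith) (by linarith)
      nlinarith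
    linarith

lemma slopeDefect_nonneg {K : ℝ} (hK : 1.94 ≤ K) : 0 ≤ slopeDefect K := by
  have hm := meanGrowth_pos (by linarith : 0 < K)
  have h1 : 2.76 ≤ K ^ 2 - 1 := by nlinarith
  have h2 : 0 ≤ 1 / meanGrowth K := by positivity
  unfold slopeDefect
  generalize K ^ 2 - 1 = t at *
  generalize 1 / meanGrowth K = y at *
  have h3 : 0 ≤ t ^ 2 / 2 - t - 1 := by nlinarith
  have h4 : 0 ≤ y ^ 2 + 3 / 2 * t * y := by positivity
  linarith

lemma tendsto_sub_inv_growthSlope :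
    Tendsto (fun x => negLogCenter x - 1 / (2 * growthSlope x)) atTop (𝓝 0) := by
  have hB : Tendsto growthSlope atTop atTop := by
    refine tendsto_atTop_mono' atTop ?_ (tendsto_pow_atTop (α := ℝ) two_ne_zero)
    filter_upwards [eventually_ge_atTop 1] with x hx
    have hx0 : (0 : ℝ) < x := by linarith
    have hm : 1 ≤ meanGrowth x := by
      refine le_trans ?_ (quartic_le_meanGrowth hx0)
      have : 0 ≤ x ^ 2 / 3 + x ^ 4 / 15 + x ^ 6 / 105 + x ^ 8 / 945 := by positivity
      linarith
    have h1 : 0 ≤ x ^ 2 - 1 := by nlinarith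
    unfold growthSlope
    nlinarith
  have h := (tendsto_inv_atTop_zero.comp hB).const_mul (1 / 2 : ℝ)
  rw [mul_zero] at h
  have h2 := tendsto_negLogCenter.sub h
  rw [sub_zero] at h2
  refine h2.congr fun x => ?_
  simp only [Function.comp_apply]
  rw [one_div, one_div, mul_inv]

/-- The function `u - 1 / (2 B)` first increases from a positive value and then decreases to its
limit `0`, because its derivative changes sign only once. -/
lemma inv_growthSlope_le {K : ℝ} (hK : 1.367 ≤ K) :
    1 / (2 * growthSlope K) ≤ negLogCenter K := by
  set D : ℝ → ℝ := fun x => negLogCenter x - 1 / (2 * growthSlope x) with hD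
  have hd : ∀ x : ℝ, 1.367 ≤ x →
      HasDerivAt D (-(meanGrowth x * slopeDefect x / (x * growthSlope x ^ 2))) x := fun x hx =>
    hasDerivAt_sub_inv_growthSlope (le_trans (by norm_num) hx)
  have hfac : ∀ x : ℝ, 1.367 ≤ x → 0 < x ∧ 0 < meanGrowth x := fun x hx =>
    have h0 : 0 < x := lt_of_lt_of_le (by norm_num) hx
    ⟨h0, meanGrowth_pos h0⟩
  have hanti : ∀ s : Set ℝ, Convex ℝ s → (∀ x ∈ s, 1.367 ≤ x) →
      (∀ x ∈ s, 0 ≤ slopeDefect x) → AntitoneOn D s := by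
    intro s hs h1 h2
    refine antitoneOn_of_deriv_nonpos hs
      (fun x hx => (hd x (h1 x hx)).continuousAt.continuousWithinAt)
      (fun x hx => (hd x (h1 x (interior_subset hx))).differentiableAt.differentiableWithinAt)
      fun x hx => ?_
    have hx := interior_subset hx
    obtain ⟨h0, hm⟩ := hfac x (h1 x hx)
    have := h2 x hx
    rw [(hd x (h1 x hx)).deriv]
    exact neg_nonpos.2 (by positivity)
  have hright : ∀ x : ℝ, 1.94 ≤ x → 0 ≤ D x := by
    intro x hx
    refine le_of_tendsto tendsto_sub_inv_growthSlope ?_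
    filter_upwards [eventually_ge_atTop x] with y hy
    exact hanti (Set.Ici 1.94) (convex_Ici _) (fun z hz => le_trans (by norm_num) hz)
      (fun z hz => slopeDefect_nonneg hz) hx (hx.trans hy) hy
  have hleft : 0 ≤ D 1.367 := by
    obtain ⟨hm, hu⟩ := values_at_split
    have hB : 2.6794 ≤ growthSlope 1.367 := by
      unfold growthSlope
      calc (2.6794 : ℝ) ≤ 1 + (1.367 ^ 2 - 1) * 1.93329 := by norm_num
        _ ≤ _ := by
          have : (0 : ℝ) ≤ 1.367 ^ 2 - 1 := by norm_num
          gcongr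
    rw [hD, sub_nonneg]
    calc 1 / (2 * growthSlope 1.367) ≤ 1 / (2 * 2.6794) := by gcongr
      _ ≤ 0.1882 := by norm_num
      _ ≤ _ := hu
  suffices 0 ≤ D K from sub_nonneg.1 this
  rcases le_total 1.94 K with h | h
  · exact hright K h
  rcases le_total 0 (slopeDefect K) with hw | hw
  · refine (hright 1.94 le_rfl).trans (hanti (Set.Icc K 1.94) (convex_Icc _ _)
      (fun z hz => hK.trans hz.1) (fun z hz => hw.trans ?_) ⟨le_rfl, h⟩ ⟨h, le_rfl⟩ h)
    exact monotoneOn_slopeDefect ⟨hK, h⟩ ⟨hK.trans hz.1, hz.2⟩ hz.1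
  · have hmono : MonotoneOn D (Set.Icc 1.367 K) := by
      refine monotoneOn_of_deriv_nonneg (convex_Icc _ _)
        (fun x hx => (hd x hx.1).continuousAt.continuousWithinAt)
        (fun x hx => (hd x (interior_subset hx).1).differentiableAt.differentiableWithinAt)
        fun x hx => ?_
      have hx := interior_subset hx
      obtain ⟨h0, hm⟩ := hfac x hx.1
      have hwx : slopeDefect x ≤ 0 :=
        (monotoneOn_slopeDefect ⟨hx.1, hx.2.trans h⟩ ⟨hK, h⟩ hx.2).trans hw
      rw [(hd x hx.1).deriv]
      refine neg_nonneg.2 (div_nonpos_of_nonpos_of_nonneg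
        (mul_nonpos_of_nonneg_of_nonpos hm.le hwx) (by positivity))
    exact hleft.trans (hmono ⟨le_rfl, hK⟩ ⟨hK, le_rfl⟩ hK)

/-- The derivative of `m² u` is `(m / K) (2 B u - 1)`, which is nonnegative right of `1.367`. -/
lemma rectangle_ineq_right {K : ℝ} (hK : 1.367 ≤ K) :
    Real.log 2 ≤ meanGrowth K ^ 2 * negLogCenter K := by
  have hpos : ∀ x : ℝ, 1.367 ≤ x → 0 < x := fun x hx => lt_of_lt_of_le (by norm_num) hx
  have hd : ∀ x : ℝ, 1.367 ≤ x → HasDerivAt (fun x => meanGrowth x ^ 2 * negLogCenter x)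
      (meanGrowth x / x * (2 * growthSlope x * negLogCenter x - 1)) x := fun x hx => by
    have hx0 := hpos x hx
    have hm := meanGrowth_pos hx0
    refine (((hasDerivAt_meanGrowth hx0).pow 2).mul (hasDerivAt_negLogCenter hx0)).congr_deriv ?_
    simp only [Pi.pow_apply]
    push_cast
    field_simp
    ring
  have hmono : MonotoneOn (fun x => meanGrowth x ^ 2 * negLogCenter x) (Set.Ici 1.367) := by
    refine monotoneOn_of_deriv_nonneg (convex_Ici _)
      (fun x hx => (hd x hx).continuousAt.continuousWithinAt)
      (fun x hx => (hd x (interior_subset hx)).differentiableAt.differentiableWithinAt)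
      fun x hx => ?_
    have hx : 1.367 ≤ x := interior_subset hx
    have hx0 := hpos x hx
    have hm := meanGrowth_pos hx0
    have hB := growthSlope_pos (le_trans (by norm_num) hx)
    have h := inv_growthSlope_le hx
    rw [div_le_iff₀ (by positivity)] at h
    rw [(hd x hx).deriv]
    exact mul_nonneg (by positivity) (by linarith)
  exact (rectangle_ineq_left (by norm_num) le_rfl).trans
    (hmono (Set.self_mem_Ici) hK hK)

/-- The entropy of the rectangle model is concave at `1 / 2` up to the annealed capacity, for
every `K`. -/
lemma rectangle_curvature {K : ℝ} (hK : 0 < K) :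
    2 * Real.log 2 * K ^ 2 ≤
      Real.pi * p (rectangle K) ^ 2 * Real.exp (K ^ 2) * -Real.log (p (rectangle K)) := by
  have h : Real.log 2 ≤ meanGrowth K ^ 2 * negLogCenter K := by
    rcases le_total K 1.367 with h | h
    · exact rectangle_ineq_left hK h
    · exact rectangle_ineq_right h
  have e : Real.pi * p (rectangle K) ^ 2 * Real.exp (K ^ 2) * -Real.log (p (rectangle K)) =
      2 * K ^ 2 * (meanGrowth K ^ 2 * negLogCenter K) := by
    have h1 : Real.exp (K ^ 2) = Real.exp (K ^ 2 / 2) ^ 2 := by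
      rw [← Real.exp_nat_mul]; push_cast; rw [mul_div_cancel₀ _ two_ne_zero]
    rw [meanGrowth, scaledHalfGauss, p_rectangle hK.le, ← negLogCenter, mul_pow,
      Real.sq_sqrt (by positivity), h1]
    field_simp
  rw [e]
  have := mul_le_mul_of_nonneg_left h (by positivity : (0 : ℝ) ≤ 2 * K ^ 2)
  linarith

/-- The curvature inequality of the `u`-function model holds below the crossing. -/
lemma uFunction_curvature {K Kstar : ℝ} (hK : 0 < K) (hlt : K < Kstar)
    (hstar : crossingRatio Kstar = 2 * Real.log 2) :
    2 * Real.log 2 * K ^ 2 ≤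
      Real.pi * p (uFunction K) ^ 2 * Real.exp (K ^ 2) * -Real.log (p (uFunction K)) := by
  rw [crossingRatio_mul_sq hK, ← hstar]
  exact mul_le_mul_of_nonneg_right
    (strictAntiOn_crossingRatio hK (hK.trans hlt) hlt).le (sq_nonneg K)

end SymmetricPerceptron

theorem theorem1 :
    (∀ K : ℝ, 0 < K →
      SymmetricPerceptron.NumericalHypothesis (SymmetricPerceptron.rectangle K) →
      SymmetricPerceptron.storageCapacity (SymmetricPerceptron.rectangle K) =
        -Real.log 2 / Real.log (SymmetricPerceptron.p (SymmetricPerceptron.rectangle K))) ∧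
    (∃ Kstar : ℝ,
      0 < Kstar ∧
      (∀ K : ℝ, 0 < K → (SymmetricPerceptron.CrossingEquation K ↔ K = Kstar)) ∧
      |Kstar - 0.817| < 0.0005 ∧
      ∀ K : ℝ, 0 < K → K < Kstar →
        SymmetricPerceptron.NumericalHypothesis (SymmetricPerceptron.uFunction K) →
        SymmetricPerceptron.storageCapacity (SymmetricPerceptron.uFunction K) =
          -Real.log 2 / Real.log (SymmetricPerceptron.p (SymmetricPerceptron.uFunction K))) := by
  refine ⟨fun K hK hnum => SymmetricPerceptron.storageCapacity_rectangle hK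
    (SymmetricPerceptron.rectangle_curvature hK) hnum, ?_⟩
  obtain ⟨Kstar, h1, h2, hstar⟩ := SymmetricPerceptron.exists_crossing
  have hpos : 0 < Kstar := lt_trans (by norm_num) h1
  refine ⟨Kstar, hpos, fun K hK => ?_, ?_, fun K hK hlt hnum =>
    SymmetricPerceptron.storageCapacity_uFunction hK
      (SymmetricPerceptron.uFunction_curvature hK hlt hstar) hnum⟩
  · rw [SymmetricPerceptron.crossingEquation_iff hK, ← hstar]
    exact ⟨fun h => SymmetricPerceptron.strictAntiOn_crossingRatio.injOn hK hpos h,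
      fun h => by rw [h]⟩
  · rw [abs_lt]
    constructor <;> norm_num at h1 h2 ⊢ <;> linarith
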